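/- For finite sets $P$ (vertices) and $W$ (witnesses) of points in the plane, the witness Gabriel graph $GG^-(P,W)$ has vertex set $P$, and distinct $a,b\in P$ are adjacent if and only if the closed disk with diameter $ab$ contains no point of $W\setminus\{a,b\}$. A point set is in general position if no three of its points lie on a line and no four on a circle. For arbitrarily large $n$, namely for every $n=16m$ with $m\ge 1$, there are witness Gabriel graphs on $n$ vertices that have at least one edge and that require at least $\frac32 n-8$ witnesses, as follows. There are radii $r_1,r_2,\dots>0$ with $1.82<r_{k+1}/r_k<1.92$ for all $k$ such that the following holds. Let $P_0$ consist of sixteen evenly spaced points on each of the concentric circles with radii $r_1,\dots,r_m$, numbered $1,\dots,16$ clockwise on each circle, with point $1$ of every circle at the top. Let $G$ be the graph whose edges join, on each circle with odd index, the cyclically consecutive odd-numbered points, and, on each circle with even index, the cyclically consecutive even-numbered points; $G$ has at least one edge. (a) There is a finite set $W$ with $GG^-(P_0,W)=G$, and every finite set $W'$ with $GG^-(P_0,W')=G$ satisfies $|W'|\ge\frac32 n-8$. (b) For every $\varepsilon>0$ one can move each point of $P_0$ by less than $\varepsilon$ so that, for the resulting set $P$ of $n$ distinct points (with the corresponding graph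 $G$ on it), there is a finite set $W$ with $P\cup W$ in general position and $GG^-(P,W)=G$, and every finite set $W'$ with $GG^-(P,W')=G$ satisfies $|W'|\ge\frac32 n-8$. -/

import Mathlib

/-- The Euclidean plane. -/
abbrev Plane : Type := EuclideanSpace ℝ (Fin 2)

/-- The closed disk that has the segment `ab` as a diameter. -/
def diametralDisk (a b : Plane) : Set Plane :=
  Metric.closedBall (midpoint ℝ a b) (dist a b / 2)

/-- The witness Gabriel graph of the point set `P` (indexed by `V`) and the witness set `W`:
`u` and `v` are adjacent iff the closed disk with diameter `P u`, `P v` contains no witness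
except possibly `P u` and `P v` themselves. -/
def witnessGabrielGraph {V : Type*} (P : V → Plane) (W : Set Plane) : SimpleGraph V where
  Adj u v := u ≠ v ∧ W ∩ (diametralDisk (P u) (P v) \ {P u, P v}) = ∅
  symm := ⟨by
    rintro u v ⟨huv, h⟩
    refine ⟨huv.symm, ?_⟩
    rwa [diametralDisk, midpoint_comm, dist_comm, Set.pair_comm]⟩
  loopless := ⟨fun _ h => h.1 rfl⟩

/-- General position: no three points on a line and no four points on a circle. -/
def InGeneralPosition (S : Set Plane) : Prop :=
  (∀ T : Finset Plane, ↑T ⊆ S → T.card = 3 → ¬ Collinear ℝ (T : Set Plane)) ∧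
  (∀ T : Finset Plane, ↑T ⊆ S → T.card = 4 → ¬ EuclideanGeometry.Cospherical (T : Set Plane))

/-- Vertex `(k, j)`: the `j`-th vertex on the `k`-th circle (both counted from `0`). -/
abbrev CircleVertex (m : ℕ) : Type := Fin m × Fin 16

/-- Sixteen evenly spaced points on each of `m` concentric circles with radii `r 0, r 1, …`,
numbered clockwise on each circle, starting at the top. -/
noncomputable def concentricPoint (m : ℕ) (r : ℕ → ℝ) (v : CircleVertex m) : Plane :=
  !₂[r v.1 * Real.sin (2 * Real.pi * (v.2 : ℕ) / 16),
     r v.1 * Real.cos (2 * Real.pi * (v.2 : ℕ) / 16)]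

/-- On each circle, the vertices whose number has the same parity as the number of the circle
form a cycle (addition in `Fin 16` is modulo `16`); there are no other edges. -/
def alternatingGraph (m : ℕ) : SimpleGraph (CircleVertex m) :=
  SimpleGraph.fromRel fun u v =>
    u.1 = v.1 ∧ (u.2 : ℕ) % 2 = (u.1 : ℕ) % 2 ∧ v.2 = u.2 + 2

/-- Every finite witness set that realizes `G` as a witness Gabriel graph on the points `P`
has at least `c` elements. -/
def AtLeastWitnessesNeeded {V : Type*} (P : V → Plane) (G : SimpleGraph V) (c : ℝ) : Prop :=
  ∀ W : Finset Plane, witnessGabrielGraph P (W : Set Plane) = G → c ≤ (W.card : ℝ)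

/-! The radii grow by the factor 19/10. On each circle, cycle vertices (joined to the vertices two
steps away) alternate with isolated ones, and the parity switches from one circle to the next.

Lower bound. Take the 16m sides (consecutive vertices of a circle) and the 8(m - 1) radial pairs (an
isolated vertex and the cycle vertex in the same direction on the next circle). All are non-edges,
so each closed diametral disk holds a witness other than its end points. Two such disks are disjoint
unless the pairs share a vertex; then, apart from end points, they meet only inside open disks of
edges, where no witness can be. So the witnesses are distinct, and there are at least 24m - 8 = 3n/2
- 8 of them (`eventually_shielded_criticalPair`, `atLeastWitnessesNeeded_of_shielded`).

Realizability. It suffices to find, for each non-edge, a point of its open disk outside all closed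
disks of edges (`exists_isFree_of_not_adj`, `witnessGabrielGraph_eq`). A cycle vertex pushed
slightly outward usually serves; sides, antipodal pairs and pairs in the same direction with
isolated inner vertex need special points.

Perturbation. Everything reduces to finitely many strict inequalities between continuous functions
of the points, so it holds on a neighbourhood of the exact configuration. Vertices and witnesses can
be moved into general position within it, because the forbidden lines and circles are null sets
(`exists_inGeneralPosition_near`). -/

section GabrielWitnesses

open Filter Topology MeasureTheory

/-! ### The plane in coordinates -/

/-- The inner product in coordinates. -/
def dot (p q : Plane) : ℝ := p 0 * q 0 + p 1 * q 1

/-- The determinant in coordinates. -/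
def cross (p q : Plane) : ℝ := p 0 * q 1 - p 1 * q 0

/-- The power of `x` with respect to the circle with diameter `pq`. -/
def diamPower (p q x : Plane) : ℝ := (x 0 - p 0) * (x 0 - q 0) + (x 1 - p 1) * (x 1 - q 1)

theorem diamPower_comm (p q x : Plane) : diamPower p q x = diamPower q p x := by
  unfold diamPower; ring

theorem mem_diametralDisk {a b x : Plane} : x ∈ diametralDisk a b ↔ diamPower a b x ≤ 0 := by
  have h : dist x (midpoint ℝ a b) ^ 2 - (dist a b / 2) ^ 2 = diamPower a b x := by
    rw [div_pow, EuclideanSpace.dist_eq, EuclideanSpace.dist_eq, Real.sq_sqrt (by positivity),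
      Real.sq_sqrt (by positivity)]
    simp only [Fin.sum_univ_two, Real.dist_eq, sq_abs, midpoint_eq_smul_add, PiLp.smul_apply,
      PiLp.add_apply, smul_eq_mul, diamPower, invOf_eq_inv]
    ring
  rw [diametralDisk, Metric.mem_closedBall, ← h, sub_nonpos]
  exact (sq_le_sq₀ dist_nonneg (by positivity)).symm

theorem plane_ext {p q : Plane} (h0 : p 0 = q 0) (h1 : p 1 = q 1) : p = q := by
  ext i; fin_cases i <;> assumption

theorem mem_diametralDisk_of_neg {a b x : Plane} (h : diamPower a b x < 0) :
    x ∈ diametralDisk a b \ {a, b} := by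
  refine ⟨mem_diametralDisk.2 h.le, ?_⟩
  rintro (rfl | rfl) <;> simp [diamPower] at h

theorem sq_sum_pos {p x : Plane} (h : x ≠ p) : 0 < (x 0 - p 0) ^ 2 + (x 1 - p 1) ^ 2 := by
  by_contra hn
  have h0 : (x 0 - p 0) ^ 2 = 0 := by nlinarith [sq_nonneg (x 0 - p 0), sq_nonneg (x 1 - p 1)]
  have h1 : (x 1 - p 1) ^ 2 = 0 := by nlinarith [sq_nonneg (x 0 - p 0), sq_nonneg (x 1 - p 1)]
  exact h (plane_ext (sub_eq_zero.1 (pow_eq_zero_iff two_ne_zero |>.1 h0))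
    (sub_eq_zero.1 (pow_eq_zero_iff two_ne_zero |>.1 h1)))

/-! ### Certificates for the intersection of two disks -/

/-- Certificate that the disks with diameters `pq` and `p'q'` are disjoint. -/
theorem diamPower_add_pos {p q p' q' : Plane}
    (h : dot p p + dot q q + dot p' p' + dot q' q' +
      2 * (dot p p' + dot p q' + dot q p' + dot q q') < 6 * (dot p q + dot p' q')) (x : Plane) :
    0 < diamPower p q x + diamPower p' q' x := by
  unfold dot at h; unfold diamPower
  -- The sum is a convex quadratic in `x`, minimal at the centroid of the four points; `h` says that
  -- the minimum is positive.
  nlinarith [sq_nonneg (4 * x 0 - (p 0 + q 0 + p' 0 + q' 0)),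
    sq_nonneg (4 * x 1 - (p 1 + q 1 + p' 1 + q' 1))]

/-- If `U - a` is a combination of `p - a` and `q - a` with positive coefficients of sum
greater than one, then the disks over `ap` and `aq` meet inside the disk over `aU`. -/
theorem diamPower_neg_of_cone {a p q x : Plane} (U0 U1 : ℝ)
    (h1 : 0 ≤ (U0 - a 0) * (q 1 - a 1) - (U1 - a 1) * (q 0 - a 0))
    (h2 : 0 ≤ (p 0 - a 0) * (U1 - a 1) - (p 1 - a 1) * (U0 - a 0))
    (h3 : 0 < (p 0 - a 0) * (q 1 - a 1) - (p 1 - a 1) * (q 0 - a 0))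
    (h4 : (p 0 - a 0) * (q 1 - a 1) - (p 1 - a 1) * (q 0 - a 0) <
      ((U0 - a 0) * (q 1 - a 1) - (U1 - a 1) * (q 0 - a 0)) +
      ((p 0 - a 0) * (U1 - a 1) - (p 1 - a 1) * (U0 - a 0)))
    (hp : diamPower a p x ≤ 0) (hq : diamPower a q x ≤ 0) (hx : x ≠ a) :
    (x 0 - a 0) * (x 0 - U0) + (x 1 - a 1) * (x 1 - U1) < 0 := by
  have hs := sq_sum_pos hx
  unfold diamPower at hp hq
  set A := (U0 - a 0) * (q 1 - a 1) - (U1 - a 1) * (q 0 - a 0) with hA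
  set B := (p 0 - a 0) * (U1 - a 1) - (p 1 - a 1) * (U0 - a 0) with hB
  set D := (p 0 - a 0) * (q 1 - a 1) - (p 1 - a 1) * (q 0 - a 0) with hD
  -- Cramer's rule: D(U - a) = A(p - a) + B(q - a). The excess A + B - D leaves a negative multiple
  -- of |x - a|².
  have key : D * ((x 0 - a 0) * (x 0 - U0) + (x 1 - a 1) * (x 1 - U1)) =
      A * ((x 0 - a 0) * (x 0 - p 0) + (x 1 - a 1) * (x 1 - p 1)) +
      B * ((x 0 - a 0) * (x 0 - q 0) + (x 1 - a 1) * (x 1 - q 1)) -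
      (A + B - D) * ((x 0 - a 0) ^ 2 + (x 1 - a 1) ^ 2) := by
    rw [hA, hB, hD]; ring
  have hneg : D * ((x 0 - a 0) * (x 0 - U0) + (x 1 - a 1) * (x 1 - U1)) < 0 := by
    rw [key]
    have := mul_nonpos_of_nonneg_of_nonpos h1 hp
    have := mul_nonpos_of_nonneg_of_nonpos h2 hq
    have := mul_pos (sub_pos.2 h4) hs
    linarith
  exact (pos_iff_neg_of_mul_neg hneg).1 h3

/-- If the angle at `c` is obtuse, then the disks over `ac` and `cb` meet inside that over `ab`. -/
theorem diamPower_neg_of_obtuse {a b c x : Plane} (h : diamPower a b c < 0)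
    (ha : diamPower a c x ≤ 0) (hb : diamPower c b x ≤ 0) : diamPower a b x < 0 := by
  unfold diamPower at *
  -- The power over `ab` at `x` is the sum of those over `ac` and `cb`, plus its own value at `c`,
  -- minus |x - c|².
  nlinarith [sq_nonneg (x 0 - c 0), sq_nonneg (x 1 - c 1)]

/-- A certificate that the disks over `ua` and `uv` meet inside the disk over `ab`. -/
theorem diamPower_neg_of_lens {u a b v x : Plane}
    (h : 49 * dot u u + 4 * dot a a + 16 * dot b b + dot v v + 28 * dot u a - 56 * dot u b
      + 14 * dot u v - 16 * dot a b + 4 * dot a v - 8 * dot b v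
      + 48 * dot a b - 72 * dot u a - 12 * dot u v < 0)
    (ha : diamPower u a x ≤ 0) (hv : diamPower u v x ≤ 0) : diamPower a b x < 0 := by
  -- The multipliers 3/2 and 1/4 sum to more than one, so the difference is concave in `x`;
  -- completing the square shows that `h` makes its maximum negative.
  have key : 48 * (diamPower a b x - 3 / 2 * diamPower u a x - 1 / 4 * diamPower u v x) =
      (49 * dot u u + 4 * dot a a + 16 * dot b b + dot v v + 28 * dot u a - 56 * dot u b
      + 14 * dot u v - 16 * dot a b + 4 * dot a v - 8 * dot b v
      + 48 * dot a b - 72 * dot u a - 12 * dot u v)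
      - (6 * x 0 - (7 * u 0 + 2 * a 0 - 4 * b 0 + v 0)) ^ 2
      - (6 * x 1 - (7 * u 1 + 2 * a 1 - 4 * b 1 + v 1)) ^ 2 := by
    unfold diamPower dot; ring
  nlinarith [sq_nonneg (6 * x 0 - (7 * u 0 + 2 * a 0 - 4 * b 0 + v 0)),
    sq_nonneg (6 * x 1 - (7 * u 1 + 2 * a 1 - 4 * b 1 + v 1))]

/-! ### Cosines and sines of the multiples of `π / 8` -/

/-- `cos (π d / 8)`. -/
noncomputable def cosTable (d : Fin 16) : ℝ := Real.cos (2 * Real.pi * (d : ℕ) / 16)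

/-- `sin (π d / 8)`. -/
noncomputable def sinTable (d : Fin 16) : ℝ := Real.sin (2 * Real.pi * (d : ℕ) / 16)

/-- Subtraction of indices is modulo 16, so angles agree up to a full turn; inner products and
determinants therefore depend only on radii and index differences. -/
theorem angle_sub (i j : Fin 16) : ∃ e : ℤ, 2 * Real.pi * ((i - j : Fin 16) : ℕ) / 16 =
    2 * Real.pi * (i : ℕ) / 16 - 2 * Real.pi * (j : ℕ) / 16 + e * (2 * Real.pi) := by
  rcases le_or_gt j i with h | h
  · refine ⟨0, ?_⟩
    rw [Fin.coe_sub_iff_le.2 h, Nat.cast_sub (by exact_mod_cast h)]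
    push_cast; ring
  · refine ⟨1, ?_⟩
    rw [Fin.coe_sub_iff_lt.2 h, Nat.cast_sub (by omega)]
    push_cast; ring

theorem dot_concentricPoint (m : ℕ) (r : ℕ → ℝ) (v w : CircleVertex m) :
    dot (concentricPoint m r v) (concentricPoint m r w) =
      r v.1 * r w.1 * cosTable (v.2 - w.2) := by
  obtain ⟨e, he⟩ := angle_sub v.2 w.2
  rw [cosTable, he, Real.cos_add_int_mul_two_pi, Real.cos_sub]
  simp [dot, concentricPoint]; ring

theorem cross_concentricPoint (m : ℕ) (r : ℕ → ℝ) (v w : CircleVertex m) :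
    cross (concentricPoint m r v) (concentricPoint m r w) =
      r v.1 * r w.1 * sinTable (v.2 - w.2) := by
  obtain ⟨e, he⟩ := angle_sub v.2 w.2
  rw [sinTable, he, Real.sin_add_int_mul_two_pi, Real.sin_sub]
  simp [cross, concentricPoint]; ring

/-- `cos (π / 8)`. -/
noncomputable def c1 : ℝ := Real.cos (Real.pi / 8)

/-- `cos (π / 4)`. -/
noncomputable def c2 : ℝ := Real.cos (Real.pi / 4)

/-- `sin (π / 8) = cos (3 π / 8)`. -/
noncomputable def c3 : ℝ := Real.sin (Real.pi / 8)

theorem c2_sq : c2 ^ 2 = 1 / 2 := by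
  rw [c2, Real.cos_pi_div_four, div_pow, Real.sq_sqrt (by norm_num)]; norm_num

theorem c1_sq : 2 * c1 ^ 2 = 1 + c2 := by
  have := Real.cos_two_mul (Real.pi / 8)
  rw [c1, c2, show Real.pi / 4 = 2 * (Real.pi / 8) by ring, this]; ring

theorem c3_sq : c3 ^ 2 = 1 - c1 ^ 2 := by
  have := Real.sin_sq_add_cos_sq (Real.pi / 8)
  rw [c1, c3]; linarith

theorem c2_bounds : 0.7071 < c2 ∧ c2 < 0.70711 := by
  have h0 : 0 < c2 := Real.cos_pos_of_mem_Ioo ⟨by linarith [Real.pi_pos], by linarith [Real.pi_pos]⟩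
  have := c2_sq
  constructor <;> nlinarith

theorem c1_bounds : 0.92387 < c1 ∧ c1 < 0.9239 := by
  have h0 : 0 < c1 := Real.cos_pos_of_mem_Ioo ⟨by linarith [Real.pi_pos], by linarith [Real.pi_pos]⟩
  have := c1_sq
  have := c2_bounds
  constructor <;> nlinarith

theorem c3_bounds : 0.3826 < c3 ∧ c3 < 0.3827 := by
  have h0 : 0 < c3 := Real.sin_pos_of_pos_of_lt_pi (by linarith [Real.pi_pos])
    (by linarith [Real.pi_pos])
  have h1 := c1_sq
  have h2 := c2_bounds
  have h3 := c3_sq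
  constructor <;> nlinarith

theorem cosTable_values : cosTable 0 = 1 ∧ cosTable 1 = c1 ∧ cosTable 2 = c2 ∧ cosTable 3 = c3 ∧
    cosTable 4 = 0 ∧ cosTable 5 = -c3 ∧ cosTable 6 = -c2 ∧ cosTable 7 = -c1 ∧ cosTable 8 = -1 ∧
    cosTable 9 = -c1 ∧ cosTable 10 = -c2 ∧ cosTable 11 = -c3 ∧ cosTable 12 = 0 ∧
    cosTable 13 = c3 ∧ cosTable 14 = c2 ∧ cosTable 15 = c1 := by
  have hs (a b : ℝ) (h : a = Real.pi + b) : Real.cos a = -Real.cos b := by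
    rw [h, add_comm, Real.cos_add_pi]
  have hr (a b : ℝ) (h : a = 2 * Real.pi - b) : Real.cos a = Real.cos b := by
    rw [h, Real.cos_two_pi_sub]
  have hm (a b : ℝ) (h : a = Real.pi - b) : Real.cos a = -Real.cos b := by
    rw [h, Real.cos_pi_sub]
  have h3 : c3 = Real.cos (3 * Real.pi / 8) := by
    rw [c3, ← Real.cos_pi_div_two_sub]; congr 1; ring
  have h4 : (0 : ℝ) = Real.cos (Real.pi / 2) := Real.cos_pi_div_two.symm
  have h0 : (1 : ℝ) = Real.cos 0 := Real.cos_zero.symm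
  rw [h3, c1, c2]
  refine ⟨by simp [cosTable], ?_, ?_, ?_, ?_, ?_, ?_, ?_, ?_, ?_, ?_, ?_, ?_, ?_, ?_, ?_⟩ <;>
    simp only [cosTable, Fin.coe_ofNat_eq_mod, Nat.reduceMod, Nat.cast_ofNat, Nat.cast_one]
  · congr 1; ring
  · congr 1; ring
  · congr 1; ring
  · rw [h4]; congr 1; ring
  · apply hm; ring
  · apply hm; ring
  · apply hm; ring
  · rw [h0]; apply hm; ring
  · apply hs; ring
  · apply hs; ring
  · apply hs; ring
  · rw [h4]; apply hr; ring
  · apply hr; ring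
  · apply hr; ring
  · apply hr; ring

theorem sinTable_eq (d : Fin 16) : sinTable d = cosTable (d - 4) := by
  obtain ⟨e, he⟩ := angle_sub d 4
  rw [cosTable, he, Real.cos_add_int_mul_two_pi, sinTable, ← Real.cos_sub_pi_div_two]
  congr 1; norm_num; ring

theorem cosTable_le_one (d : Fin 16) : cosTable d ≤ 1 := Real.cos_le_one _

variable {m : ℕ}

/-! ### The radii and the graph -/

/-- The radii of the concentric circles. -/
noncomputable def rad (k : ℕ) : ℝ := (19 / 10) ^ k

theorem rad_pos (k : ℕ) : 0 < rad k := by unfold rad; positivity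

theorem rad_succ (k : ℕ) : rad (k + 1) = 19 / 10 * rad k := by unfold rad; ring

theorem rad_mono {k l : ℕ} (h : k ≤ l) : rad k ≤ rad l :=
  pow_le_pow_right₀ (by norm_num) h

theorem rad_lt {k l : ℕ} (h : k < l) : 19 / 10 * rad k ≤ rad l := by
  rw [← rad_succ]; exact rad_mono h

/-- The concentric points with the chosen radii. -/
noncomputable def basePoint (m : ℕ) : CircleVertex m → Plane := concentricPoint m rad

/-- The vertices that have neighbours. -/
def IsCycleVertex (v : CircleVertex m) : Prop := (v.2 : ℕ) % 2 = (v.1 : ℕ) % 2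

instance (v : CircleVertex m) : Decidable (IsCycleVertex v) := by
  unfold IsCycleVertex; infer_instance

theorem adj_iff {u v : CircleVertex m} : (alternatingGraph m).Adj u v ↔
    u.1 = v.1 ∧ IsCycleVertex u ∧ (v.2 = u.2 + 2 ∨ u.2 = v.2 + 2) := by
  obtain ⟨k, i⟩ := u
  obtain ⟨l, j⟩ := v
  have ne : ∀ i : Fin 16, i ≠ i + 2 := by decide
  simp only [alternatingGraph, SimpleGraph.fromRel_adj, IsCycleVertex, ne_eq, Prod.mk.injEq]
  constructor
  · rintro ⟨-, ⟨rfl, h, rfl⟩ | ⟨rfl, h, rfl⟩⟩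
    · exact ⟨rfl, h, Or.inl rfl⟩
    · refine ⟨rfl, ?_, Or.inr rfl⟩
      rw [← h, Fin.val_add]; simp only [Fin.coe_ofNat_eq_mod]; omega
  · rintro ⟨rfl, h, rfl | rfl⟩
    · exact ⟨fun h => absurd h.2 (ne i), Or.inl ⟨rfl, h, rfl⟩⟩
    · refine ⟨fun h => absurd h.2.symm (ne j), Or.inr ⟨rfl, ?_, rfl⟩⟩
      rw [← h, Fin.val_add]; simp only [Fin.coe_ofNat_eq_mod]; omega

theorem isCycleVertex_add_one {k : Fin m} {j : Fin 16} :
    IsCycleVertex (k, j + 1) ↔ ¬ IsCycleVertex (k, j) := by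
  simp only [IsCycleVertex, Fin.val_add, Fin.coe_ofNat_eq_mod]; omega

theorem isCycleVertex_sub_one {k : Fin m} {j : Fin 16} :
    IsCycleVertex (k, j - 1) ↔ ¬ IsCycleVertex (k, j) := by
  have := isCycleVertex_add_one (k := k) (j := j - 1)
  rw [sub_add_cancel] at this; tauto

theorem isCycleVertex_add_two {k : Fin m} {j : Fin 16} :
    IsCycleVertex (k, j + 2) ↔ IsCycleVertex (k, j) := by
  simp only [IsCycleVertex, Fin.val_add, Fin.coe_ofNat_eq_mod]; omega

theorem isCycleVertex_succ {k l : Fin m} {j : Fin 16} (h : (l : ℕ) = k + 1) :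
    IsCycleVertex (l, j) ↔ ¬ IsCycleVertex (k, j) := by
  simp only [IsCycleVertex]; omega

/-! ### Pairs of vertices whose disks meet only inside disks of edges -/

/-- The disks over the two pairs meet, apart from end points, only inside disks of edges. -/
def Shielded (P : CircleVertex m → Plane) (p q : CircleVertex m × CircleVertex m) : Prop :=
  ∀ x, diamPower (P p.1) (P p.2) x ≤ 0 → x ≠ P p.1 → x ≠ P p.2 →
    diamPower (P q.1) (P q.2) x ≤ 0 → x ≠ P q.1 → x ≠ P q.2 →
    ∃ a b, (alternatingGraph m).Adj a b ∧ diamPower (P a) (P b) x < 0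

theorem Shielded.symm {P : CircleVertex m → Plane} {p q : CircleVertex m × CircleVertex m}
    (h : Shielded P p q) : Shielded P q p :=
  fun x h1 h2 h3 h4 h5 h6 => h x h4 h5 h6 h1 h2 h3

theorem Shielded.swap_left {P : CircleVertex m → Plane} {p q : CircleVertex m × CircleVertex m}
    (h : Shielded P p q) : Shielded P p.swap q :=
  fun x h1 h2 h3 h4 h5 h6 => h x (by rwa [diamPower_comm]) h3 h2 h4 h5 h6

theorem Shielded.swap_right {P : CircleVertex m → Plane} {p q : CircleVertex m × CircleVertex m}
    (h : Shielded P p q) : Shielded P p q.swap := h.symm.swap_left.symm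

theorem dot_base (v w : CircleVertex m) : dot (basePoint m v) (basePoint m w) =
    rad v.1 * rad w.1 * cosTable (v.2 - w.2) := dot_concentricPoint m rad v w

theorem cross_base (v w : CircleVertex m) : cross (basePoint m v) (basePoint m w) =
    rad v.1 * rad w.1 * sinTable (v.2 - w.2) := cross_concentricPoint m rad v w

/-! ### Shielding as an open condition on the configuration -/

@[fun_prop]
theorem continuous_dot (u v : CircleVertex m) :
    Continuous fun P : CircleVertex m → Plane => dot (P u) (P v) := by
  unfold dot; fun_prop

@[fun_prop]
theorem continuous_cross (u v : CircleVertex m) :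
    Continuous fun P : CircleVertex m → Plane => cross (P u) (P v) := by
  unfold cross; fun_prop

theorem eventually_lt_of_continuous {X : Type*} [TopologicalSpace X] {f g : X → ℝ} {a : X}
    (h : f a < g a) (hf : Continuous f) (hg : Continuous g) :
    ∀ᶠ x in 𝓝 a, f x < g x :=
  hf.continuousAt.eventually_lt hg.continuousAt h

/-- The hypothesis is the certificate of `diamPower_add_pos` at the base configuration. It persists
nearby, where the disks are disjoint and shielding is vacuous. -/
theorem eventually_shielded_of_separated (p q p' q' : CircleVertex m)
    (h : rad p.1 ^ 2 + rad q.1 ^ 2 + rad p'.1 ^ 2 + rad q'.1 ^ 2 +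
      2 * (rad p.1 * rad p'.1 * cosTable (p.2 - p'.2) + rad p.1 * rad q'.1 * cosTable (p.2 - q'.2)
        + rad q.1 * rad p'.1 * cosTable (q.2 - p'.2) + rad q.1 * rad q'.1 * cosTable (q.2 - q'.2))
      < 6 * (rad p.1 * rad q.1 * cosTable (p.2 - q.2)
        + rad p'.1 * rad q'.1 * cosTable (p'.2 - q'.2))) :
    ∀ᶠ P in 𝓝 (basePoint m), Shielded P (p, q) (p', q') := by
  have key := eventually_lt_of_continuous (X := CircleVertex m → Plane) (a := basePoint m)
    (f := fun P => dot (P p) (P p) + dot (P q) (P q) + dot (P p') (P p') + dot (P q') (P q') +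
      2 * (dot (P p) (P p') + dot (P p) (P q') + dot (P q) (P p') + dot (P q) (P q')))
    (g := fun P => 6 * (dot (P p) (P q) + dot (P p') (P q')))
    (by simp only [dot_base, sub_self, cosTable_values.1]; linarith) (by fun_prop) (by fun_prop)
  filter_upwards [key] with P hP x h1 _ _ h2
  have := diamPower_add_pos hP x
  simp only at h1 h2
  linarith

theorem forall_fin16 {p : Fin 16 → Prop} (h0 : p 0) (h1 : p 1) (h2 : p 2) (h3 : p 3) (h4 : p 4)
    (h5 : p 5) (h6 : p 6) (h7 : p 7) (h8 : p 8) (h9 : p 9) (h10 : p 10) (h11 : p 11)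
    (h12 : p 12) (h13 : p 13) (h14 : p 14) (h15 : p 15) (d : Fin 16) : p d := by
  fin_cases d <;> assumption

/-! ### Two sides -/

theorem separated_side_side_of_lt {k l : Fin m} (hkl : k < l) (i j : Fin 16) :
    ∀ᶠ P in 𝓝 (basePoint m), Shielded P ((k, i), (k, i + 1)) ((l, j), (l, j + 1)) := by
  apply eventually_shielded_of_separated
  have h := rad_lt (show (k : ℕ) < l from hkl)
  have hk := rad_pos k
  have e1 (j : Fin 16) : j - (j + 1) = 15 := by revert j; decide
  obtain ⟨-, -, -, -, -, -, -, -, -, -, -, -, -, -, -, t15⟩ := cosTable_values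
  obtain ⟨hc, -⟩ := c1_bounds
  simp only [e1, t15]
  have c (d : Fin 16) : rad k * rad l * cosTable d ≤ rad k * rad l := by
    have := mul_pos hk (hk.trans_le (by linarith : rad k ≤ rad l))
    nlinarith [cosTable_le_one d]
  have := c (i - j)
  have := c (i - (j + 1))
  have := c (i + 1 - j)
  have := c (i + 1 - (j + 1))
  nlinarith [mul_nonneg (sub_nonneg.2 h) hk.le, mul_pos hk hk, sq_nonneg (rad l - 19 / 10 * rad k),
    mul_lt_mul_of_pos_left hc (mul_pos hk hk),
    mul_le_mul_of_nonneg_left hc.le (mul_self_nonneg (rad l))]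

theorem separated_side_side_of_eq (k : Fin m) (j d : Fin 16) (h0 : d ≠ 0) (h1 : d ≠ 1)
    (h15 : d ≠ 15) :
    ∀ᶠ P in 𝓝 (basePoint m),
      Shielded P ((k, j), (k, j + 1)) ((k, j + d), (k, j + d + 1)) := by
  apply eventually_shielded_of_separated
  have hk := rad_pos k
  obtain ⟨hc, hc'⟩ := c1_bounds
  obtain ⟨hc2', hc2⟩ := c2_bounds
  obtain ⟨h3, hc3⟩ := c3_bounds
  have e1 : j - (j + 1) = 15 := by grind
  have e2 : j + d - (j + d + 1) = 15 := by grind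
  have e3 : j - (j + d) = 0 - d := by grind
  have e4 : j - (j + d + 1) = 15 - d := by grind
  have e5 : j + 1 - (j + d) = 1 - d := by grind
  have e6 : j + 1 - (j + d + 1) = 0 - d := by grind
  simp only [e1, e2, e3, e4, e5, e6, cosTable_values]
  -- After division by the squared radius the certificate asks for less than 6 `c1` - 2 ≈ 3.543.
  have key : 2 * cosTable (0 - d) + cosTable (15 - d) + cosTable (1 - d) < 3.54 := by
    revert d
    refine forall_fin16 ?_ ?_ ?_ ?_ ?_ ?_ ?_ ?_ ?_ ?_ ?_ ?_ ?_ ?_ ?_ ?_ <;> intros <;>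
      simp only [Fin.reduceSub, cosTable_values] <;> first | contradiction | linarith
  nlinarith [mul_pos hk hk, mul_lt_mul_of_pos_left key (mul_pos hk hk),
    mul_lt_mul_of_pos_left hc (mul_pos hk hk)]

theorem sinTable_values : sinTable 0 = 0 ∧ sinTable 1 = c3 ∧ sinTable 2 = c2 ∧ sinTable 3 = c1 ∧
    sinTable 13 = -c1 ∧ sinTable 14 = -c2 ∧ sinTable 15 = -c3 := by
  simp only [sinTable_eq, Fin.reduceSub, cosTable_values, and_self]

/-- If the midpoint of `bz` is, as seen from `a`, a positive combination of `p` and `q` with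
coefficient sum greater than one, then the edges `ab` and `az` shield `ap` from `aq`. -/
theorem eventually_shielded_of_cone (a p q b z : CircleVertex m)
    (hb : (alternatingGraph m).Adj a b) (hz : (alternatingGraph m).Adj a z)
    (h : let c := fun v w : CircleVertex m => rad v.1 * rad w.1 * sinTable (v.2 - w.2)
      0 < c b q + c z q - c b a - c z a - 2 * c a q ∧
      0 < c p b + c p z - 2 * c p a - c a b - c a z ∧
      0 < 2 * (c p q - c p a - c a q) ∧
      2 * (c p q - c p a - c a q) < (c b q + c z q - c b a - c z a - 2 * c a q) +
        (c p b + c p z - 2 * c p a - c a b - c a z)) :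
    ∀ᶠ P in 𝓝 (basePoint m), Shielded P (a, p) (a, q) := by
  obtain ⟨h1, h2, h3, h4⟩ := h
  simp only [← cross_base] at h1 h2 h3 h4
  have k1 := eventually_lt_of_continuous (X := CircleVertex m → Plane) (a := basePoint m)
    (f := fun _ => 0) (g := fun P => cross (P b) (P q) + cross (P z) (P q) - cross (P b) (P a)
      - cross (P z) (P a) - 2 * cross (P a) (P q)) h1 (by fun_prop) (by fun_prop)
  have k2 := eventually_lt_of_continuous (X := CircleVertex m → Plane) (a := basePoint m)
    (f := fun _ => 0) (g := fun P => cross (P p) (P b) + cross (P p) (P z)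
      - 2 * cross (P p) (P a) - cross (P a) (P b) - cross (P a) (P z)) h2 (by fun_prop)
    (by fun_prop)
  have k3 := eventually_lt_of_continuous (X := CircleVertex m → Plane) (a := basePoint m)
    (f := fun _ => 0) (g := fun P => 2 * (cross (P p) (P q) - cross (P p) (P a)
      - cross (P a) (P q))) h3 (by fun_prop) (by fun_prop)
  have k4 := eventually_lt_of_continuous (X := CircleVertex m → Plane) (a := basePoint m)
    (f := fun P => 2 * (cross (P p) (P q) - cross (P p) (P a) - cross (P a) (P q)))
    (g := fun P => (cross (P b) (P q) + cross (P z) (P q) - cross (P b) (P a)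
      - cross (P z) (P a) - 2 * cross (P a) (P q)) + (cross (P p) (P b) + cross (P p) (P z)
      - 2 * cross (P p) (P a) - cross (P a) (P b) - cross (P a) (P z))) h4 (by fun_prop)
    (by fun_prop)
  filter_upwards [k1, k2, k3, k4] with P g1 g2 g3 g4 x hp hxa _ hq _ _
  simp only [cross] at g1 g2 g3 g4
  have key := diamPower_neg_of_cone (a := P a) (p := P p) (q := P q) (x := x)
    ((P b 0 + P z 0) / 2) ((P b 1 + P z 1) / 2) (by linarith) (by linarith) (by linarith)
    (by linarith) hp hq hxa
  -- The powers over `ab` and `az` add up to twice the expression made negative by `key`, so one of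
  -- them is negative.
  by_contra hcon
  push Not at hcon
  have n1 := hcon a b hb
  have n2 := hcon a z hz
  unfold diamPower at n1 n2
  linarith

/-- By symmetry, the midpoint of the two cycle neighbours lies on the bisector of the angle between
the sides, beyond the chord joining their other ends. -/
theorem shielded_side_side_at_cycleVertex (k : Fin m) (j : Fin 16) (hj : IsCycleVertex (k, j)) :
    ∀ᶠ P in 𝓝 (basePoint m), Shielded P ((k, j), (k, j - 1)) ((k, j), (k, j + 1)) := by
  have hk := rad_pos k
  obtain ⟨hc, hc'⟩ := c1_bounds
  obtain ⟨hc2, hc2'⟩ := c2_bounds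
  obtain ⟨h3, hc3⟩ := c3_bounds
  refine eventually_shielded_of_cone _ _ _ (k, j + 2) (k, j - 2)
    (adj_iff.2 ⟨rfl, hj, Or.inl rfl⟩) (adj_iff.2 ⟨rfl, hj, Or.inr (by grind)⟩) ?_
  have e1 : j + 2 - (j + 1) = 1 := by grind
  have e2 : j - 2 - (j + 1) = 13 := by grind
  have e3 : j + 2 - j = 2 := by grind
  have e4 : j - 2 - j = 14 := by grind
  have e5 : j - (j + 1) = 15 := by grind
  have e6 : j - 1 - (j + 2) = 13 := by grind
  have e7 : j - 1 - (j - 2) = 1 := by grind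
  have e8 : j - 1 - j = 15 := by grind
  have e9 : j - (j + 2) = 14 := by grind
  have e10 : j - (j - 2) = 2 := by grind
  have e11 : j - 1 - (j + 1) = 14 := by grind
  simp only [e1, e2, e3, e4, e5, e6, e7, e8, e9, e10, e11, sinTable_values]
  have := mul_pos hk hk
  have a1 := mul_lt_mul_of_pos_left hc' this
  have a2 := mul_lt_mul_of_pos_left h3 this
  have a3 := mul_lt_mul_of_pos_left hc2 this
  have a4 := mul_lt_mul_of_pos_left hc2' this
  have a5 := mul_lt_mul_of_pos_left hc3 this
  refine ⟨?_, ?_, ?_, ?_⟩ <;> linarith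

/-- The two neighbours of an isolated vertex on its circle form an edge, which is seen from that
vertex at an obtuse angle. -/
theorem shielded_side_side_at_not_cycleVertex (k : Fin m) (j : Fin 16)
    (hj : ¬ IsCycleVertex (k, j)) :
    ∀ᶠ P in 𝓝 (basePoint m), Shielded P ((k, j), (k, j - 1)) ((k, j), (k, j + 1)) := by
  have hk := rad_pos k
  have hadj : (alternatingGraph m).Adj (k, j - 1) (k, j + 1) :=
    adj_iff.2 ⟨rfl, isCycleVertex_sub_one.2 hj, Or.inl (by grind)⟩
  have h := eventually_lt_of_continuous (X := CircleVertex m → Plane) (a := basePoint m)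
    (f := fun P => dot (P (k, j - 1)) (P (k, j + 1)) + dot (P (k, j)) (P (k, j)))
    (g := fun P => dot (P (k, j)) (P (k, j - 1)) + dot (P (k, j)) (P (k, j + 1)))
    (by
      obtain ⟨hc, hc'⟩ := c1_bounds
      obtain ⟨hc2, hc2'⟩ := c2_bounds
      have e1 : j - (j + 1) = 15 := by grind
      have e2 : j - (j - 1) = 1 := by grind
      have e3 : j - 1 - (j + 1) = 14 := by grind
      simp only [dot_base, e1, e2, e3, sub_self, cosTable_values]
      have := mul_pos hk hk
      nlinarith [mul_lt_mul_of_pos_left hc this, mul_lt_mul_of_pos_left hc2' this])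
    (by fun_prop) (by fun_prop)
  filter_upwards [h] with P hP x h1 _ _ h2 _ _
  refine ⟨_, _, hadj, diamPower_neg_of_obtuse (c := P (k, j)) ?_ ?_ h2⟩
  · unfold dot at hP; unfold diamPower; linarith
  · rwa [diamPower_comm]

/-! ### A side and a radial pair -/

theorem shielded_side_radial_at_inner {k l : Fin m} (hl : (l : ℕ) = k + 1) {j a b : Fin 16}
    (hab : (alternatingGraph m).Adj (k, a) (k, b)) (ha : j - a = 1 ∧ j - b = 15 ∨
      j - a = 15 ∧ j - b = 1) :
    ∀ᶠ P in 𝓝 (basePoint m), Shielded P ((k, j), (k, a)) ((k, j), (l, j)) := by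
  have hk := rad_pos k
  have hl' : rad l = 19 / 10 * rad k := by rw [hl, rad_succ]
  -- The shared vertex is isolated, so no edge starts there; the edge passing over it, between its
  -- two neighbours, covers the lens.
  have h := eventually_lt_of_continuous (X := CircleVertex m → Plane) (a := basePoint m)
    (f := fun P => 49 * dot (P (k, j)) (P (k, j)) + 4 * dot (P (k, a)) (P (k, a))
      + 16 * dot (P (k, b)) (P (k, b)) + dot (P (l, j)) (P (l, j))
      + 28 * dot (P (k, j)) (P (k, a)) - 56 * dot (P (k, j)) (P (k, b))
      + 14 * dot (P (k, j)) (P (l, j)) - 16 * dot (P (k, a)) (P (k, b))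
      + 4 * dot (P (k, a)) (P (l, j)) - 8 * dot (P (k, b)) (P (l, j))
      + 48 * dot (P (k, a)) (P (k, b)) - 72 * dot (P (k, j)) (P (k, a))
      - 12 * dot (P (k, j)) (P (l, j)))
    (g := fun _ => 0)
    (by
      obtain ⟨hc, hc'⟩ := c1_bounds
      obtain ⟨hc2, hc2'⟩ := c2_bounds
      have := mul_pos hk hk
      have a1 := mul_lt_mul_of_pos_left hc this
      have a2 := mul_lt_mul_of_pos_left hc2' this
      rcases ha with ⟨e1, e2⟩ | ⟨e1, e2⟩
      · have e3 : a - j = 15 := by grind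
        have e4 : b - j = 1 := by grind
        have e5 : a - b = 14 := by grind
        simp only [dot_base, e1, e2, e3, e4, e5, sub_self, cosTable_values, hl']
        nlinarith
      · have e3 : a - j = 1 := by grind
        have e4 : b - j = 15 := by grind
        have e5 : a - b = 2 := by grind
        simp only [dot_base, e1, e2, e3, e4, e5, sub_self, cosTable_values, hl']
        nlinarith)
    (by fun_prop) (by fun_prop)
  filter_upwards [h] with P hP x h1 _ _ h2 _ _
  exact ⟨_, _, hab, diamPower_neg_of_lens hP h1 h2⟩

/-- Seen from the shared cycle vertex, its cycle neighbour lies between the side and the inward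
radius, beyond the line joining their ends. The mirror case lists the pairs in the other order to
keep the determinant positive. -/
theorem shielded_side_radial_at_outer_add {k l : Fin m} (hl : (l : ℕ) = k + 1) {j : Fin 16}
    (hj : IsCycleVertex (l, j)) :
    ∀ᶠ P in 𝓝 (basePoint m), Shielded P ((l, j), (k, j)) ((l, j), (l, j + 1)) := by
  have hk := rad_pos k
  have hl' : rad l = 19 / 10 * rad k := by rw [hl, rad_succ]
  have hadj : (alternatingGraph m).Adj (l, j) (l, j + 2) := adj_iff.2 ⟨rfl, hj, Or.inl rfl⟩
  refine eventually_shielded_of_cone _ _ _ (l, j + 2) (l, j + 2) hadj hadj ?_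
  obtain ⟨hc, hc'⟩ := c1_bounds
  obtain ⟨hc2, hc2'⟩ := c2_bounds
  obtain ⟨h3, hc3⟩ := c3_bounds
  have e1 : j + 2 - (j + 1) = 1 := by grind
  have e3 : j + 2 - j = 2 := by grind
  have e5 : j - (j + 1) = 15 := by grind
  have e9 : j - (j + 2) = 14 := by grind
  simp only [e1, e3, e5, e9, sub_self, sinTable_values, hl']
  have := mul_pos hk hk
  have a2 := mul_lt_mul_of_pos_left h3 this
  have a3 := mul_lt_mul_of_pos_left hc2 this
  have a4 := mul_lt_mul_of_pos_left hc2' this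
  have a5 := mul_lt_mul_of_pos_left hc3 this
  refine ⟨?_, ?_, ?_, ?_⟩ <;> nlinarith

theorem shielded_side_radial_at_outer_sub {k l : Fin m} (hl : (l : ℕ) = k + 1) {j : Fin 16}
    (hj : IsCycleVertex (l, j)) :
    ∀ᶠ P in 𝓝 (basePoint m), Shielded P ((l, j), (l, j - 1)) ((l, j), (k, j)) := by
  have hk := rad_pos k
  have hl' : rad l = 19 / 10 * rad k := by rw [hl, rad_succ]
  have hadj : (alternatingGraph m).Adj (l, j) (l, j - 2) :=
    adj_iff.2 ⟨rfl, hj, Or.inr (by grind)⟩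
  refine eventually_shielded_of_cone _ _ _ (l, j - 2) (l, j - 2) hadj hadj ?_
  obtain ⟨hc, hc'⟩ := c1_bounds
  obtain ⟨hc2, hc2'⟩ := c2_bounds
  obtain ⟨h3, hc3⟩ := c3_bounds
  have e1 : j - 2 - j = 14 := by grind
  have e3 : j - 1 - (j - 2) = 1 := by grind
  have e5 : j - 1 - j = 15 := by grind
  have e9 : j - (j - 2) = 2 := by grind
  simp only [e1, e3, e5, e9, sub_self, sinTable_values, hl']
  have := mul_pos hk hk
  have a2 := mul_lt_mul_of_pos_left h3 this
  have a3 := mul_lt_mul_of_pos_left hc2 this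
  have a4 := mul_lt_mul_of_pos_left hc2' this
  have a5 := mul_lt_mul_of_pos_left hc3 this
  refine ⟨?_, ?_, ?_, ?_⟩ <;> nlinarith

theorem sub_add_one_eq (j : Fin 16) : j - (j + 1) = 15 := by grind

/-- A pair of consecutive vertices of a circle and a radial pair sharing no vertex. -/
theorem separated_side_radial_of_inner {k l : Fin m} (hl : (l : ℕ) = k + 1) (j d : Fin 16)
    (h0 : d ≠ 0) (h15 : d ≠ 15) :
    ∀ᶠ P in 𝓝 (basePoint m), Shielded P ((k, j + d), (k, j + d + 1)) ((k, j), (l, j)) := by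
  apply eventually_shielded_of_separated
  have hk := rad_pos k
  have hl' : rad l = 19 / 10 * rad k := by rw [hl, rad_succ]
  have e3 : j + d - j = d := by grind
  have e4 : j + d + 1 - j = d + 1 := by grind
  simp only [sub_add_one_eq, e3, e4, cosTable_values, sub_self, hl']
  obtain ⟨hc, hc'⟩ := c1_bounds
  -- With ratio 1.9 the certificate allows about 1.781; the largest sum left is `c1 + c2` ≈ 1.631.
  have key : cosTable d + cosTable (d + 1) < 1.78 := by
    obtain ⟨hc2, hc2'⟩ := c2_bounds
    obtain ⟨h3, hc3⟩ := c3_bounds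
    revert d
    refine forall_fin16 ?_ ?_ ?_ ?_ ?_ ?_ ?_ ?_ ?_ ?_ ?_ ?_ ?_ ?_ ?_ ?_ <;> intros <;>
      simp only [Fin.reduceAdd, cosTable_values] <;> first | contradiction | linarith
  nlinarith [mul_pos hk hk, mul_lt_mul_of_pos_left key (mul_pos hk hk),
    mul_lt_mul_of_pos_left hc (mul_pos hk hk)]

theorem separated_side_radial_of_outer {k l : Fin m} (hl : (l : ℕ) = k + 1) (j d : Fin 16)
    (h0 : d ≠ 0) (h15 : d ≠ 15) :
    ∀ᶠ P in 𝓝 (basePoint m), Shielded P ((l, j + d), (l, j + d + 1)) ((k, j), (l, j)) := by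
  apply eventually_shielded_of_separated
  have hk := rad_pos k
  have hl' : rad l = 19 / 10 * rad k := by rw [hl, rad_succ]
  have e3 : j + d - j = d := by grind
  have e4 : j + d + 1 - j = d + 1 := by grind
  simp only [sub_add_one_eq, e3, e4, cosTable_values, sub_self, hl']
  obtain ⟨hc, hc'⟩ := c1_bounds
  have key : cosTable d + cosTable (d + 1) < 1.65 := by
    obtain ⟨hc2, hc2'⟩ := c2_bounds
    obtain ⟨h3, hc3⟩ := c3_bounds
    revert d
    refine forall_fin16 ?_ ?_ ?_ ?_ ?_ ?_ ?_ ?_ ?_ ?_ ?_ ?_ ?_ ?_ ?_ ?_ <;> intros <;>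
      simp only [Fin.reduceAdd, cosTable_values] <;> first | contradiction | linarith
  nlinarith [mul_pos hk hk, mul_lt_mul_of_pos_left key (mul_pos hk hk),
    mul_lt_mul_of_pos_left hc (mul_pos hk hk)]

theorem mul_cosTable_le {a : ℝ} (ha : 0 ≤ a) (d : Fin 16) : a * cosTable d ≤ a :=
  mul_le_of_le_one_right ha (cosTable_le_one d)

theorem separated_side_radial_of_far {k l i : Fin m} (hl : (l : ℕ) = k + 1) (j e : Fin 16)
    (hi : i < k ∨ l < i) :
    ∀ᶠ P in 𝓝 (basePoint m), Shielded P ((i, e), (i, e + 1)) ((k, j), (l, j)) := by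
  apply eventually_shielded_of_separated
  have hk := rad_pos k
  have hi0 := rad_pos i
  have hl' : rad l = 19 / 10 * rad k := by rw [hl, rad_succ]
  have hl0 := rad_pos l
  simp only [sub_add_one_eq, cosTable_values, sub_self]
  obtain ⟨hc, hc'⟩ := c1_bounds
  have c1 := mul_cosTable_le (mul_pos hi0 hk).le (e - j)
  have c2 := mul_cosTable_le (mul_pos hi0 hl0).le (e - j)
  have c3 := mul_cosTable_le (mul_pos hi0 hk).le (e + 1 - j)
  have c4 := mul_cosTable_le (mul_pos hi0 hl0).le (e + 1 - j)
  have c5 := mul_lt_mul_of_pos_left hc (mul_pos hi0 hi0)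
  rw [hl'] at c2 c4 ⊢
  -- This is the certificate with the mixed cosines replaced by 1 and 6 `c1` - 2 rounded down to
  -- 3.54.
  have key : 11.6 * (rad i * rad k) < 3.54 * rad i ^ 2 + 6.79 * rad k ^ 2 := by
    rcases hi with hi | hi
    · have := rad_lt (show (i : ℕ) < k from hi)
      nlinarith [mul_nonneg (sub_nonneg.2 this) hi0.le, mul_pos hi0 hi0]
    · have := rad_lt (show (l : ℕ) < i from hi)
      rw [hl'] at this
      nlinarith [mul_nonneg (sub_nonneg.2 this) hk.le, mul_pos hk hk]
  nlinarith

/-! ### Two radial pairs -/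

theorem separated_radial_radial_of_eq {k l : Fin m} (hl : (l : ℕ) = k + 1) (j d : Fin 16)
    (h0 : d ≠ 0) (h1 : d ≠ 1) (h15 : d ≠ 15) :
    ∀ᶠ P in 𝓝 (basePoint m), Shielded P ((k, j), (l, j)) ((k, j + d), (l, j + d)) := by
  apply eventually_shielded_of_separated
  have hk := rad_pos k
  have hl' : rad l = 19 / 10 * rad k := by rw [hl, rad_succ]
  have e3 : j - (j + d) = 0 - d := by grind
  simp only [e3, cosTable_values, sub_self, hl']
  -- The certificate allows about 0.807: directions two steps apart pass, adjacent ones would not.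
  have key : cosTable (0 - d) < 0.8 := by
    obtain ⟨hc, hc'⟩ := c1_bounds
    obtain ⟨hc2, hc2'⟩ := c2_bounds
    obtain ⟨h3, hc3⟩ := c3_bounds
    revert d
    refine forall_fin16 ?_ ?_ ?_ ?_ ?_ ?_ ?_ ?_ ?_ ?_ ?_ ?_ ?_ ?_ ?_ ?_ <;> intros <;>
      simp only [Fin.reduceSub, cosTable_values] <;> first | contradiction | linarith
  nlinarith [mul_pos hk hk, mul_lt_mul_of_pos_left key (mul_pos hk hk)]

theorem separated_radial_radial_of_succ {k l i : Fin m} (hl : (l : ℕ) = k + 1)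
    (hi : (i : ℕ) = l + 1) (j d : Fin 16) (h0 : d ≠ 0) :
    ∀ᶠ P in 𝓝 (basePoint m), Shielded P ((k, j), (l, j)) ((l, j + d), (i, j + d)) := by
  apply eventually_shielded_of_separated
  have hk := rad_pos k
  have hl' : rad l = 19 / 10 * rad k := by rw [hl, rad_succ]
  have hi' : rad i = 19 / 10 * (19 / 10 * rad k) := by rw [hi, rad_succ, hl']
  have e3 : j - (j + d) = 0 - d := by grind
  simp only [e3, cosTable_values, sub_self, hl', hi']
  have key : cosTable (0 - d) < 0.924 := by
    obtain ⟨hc, hc'⟩ := c1_bounds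
    obtain ⟨hc2, hc2'⟩ := c2_bounds
    obtain ⟨h3, hc3⟩ := c3_bounds
    revert d
    refine forall_fin16 ?_ ?_ ?_ ?_ ?_ ?_ ?_ ?_ ?_ ?_ ?_ ?_ ?_ ?_ ?_ ?_ <;> intros <;>
      simp only [Fin.reduceSub, cosTable_values] <;> first | contradiction | linarith
  nlinarith [mul_pos hk hk, mul_lt_mul_of_pos_left key (mul_pos hk hk)]

theorem separated_radial_radial_of_far {k l i i' : Fin m} (hl : (l : ℕ) = k + 1)
    (hi : (i' : ℕ) = i + 1) (h : l < i) (j e : Fin 16) :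
    ∀ᶠ P in 𝓝 (basePoint m), Shielded P ((k, j), (l, j)) ((i, e), (i', e)) := by
  apply eventually_shielded_of_separated
  have hk := rad_pos k
  have hi0 := rad_pos i
  have hl' : rad l = 19 / 10 * rad k := by rw [hl, rad_succ]
  have hi' : rad i' = 19 / 10 * rad i := by rw [hi, rad_succ]
  simp only [cosTable_values, sub_self, hl', hi']
  have c1 := mul_cosTable_le (mul_pos hk hi0).le (j - e)
  have := rad_lt (show (l : ℕ) < i from h)
  rw [hl'] at this
  nlinarith [mul_nonneg (sub_nonneg.2 this) hk.le, mul_pos hk hk]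

/-! ### The independent family of non-edges -/

/-- Indices of the pairs of consecutive vertices on a circle and of the radial pairs. -/
abbrev PairIndex (m : ℕ) : Type := CircleVertex m ⊕ (Fin (m - 1) × Fin 8)

/-- The position of the `i`-th vertex without neighbours on the `k`-th circle. -/
def isolatedPosition (k : ℕ) (i : Fin 8) : Fin 16 :=
  ⟨2 * i + (1 - k % 2), by omega⟩

/-- The pairs of vertices that need different witnesses. -/
def criticalPair : PairIndex m → CircleVertex m × CircleVertex m
  | Sum.inl v => (v, (v.1, v.2 + 1))
  | Sum.inr (k, i) => ((⟨k, by omega⟩, isolatedPosition k i),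
      (⟨k + 1, by omega⟩, isolatedPosition k i))

theorem not_isCycleVertex_isolatedPosition (k : Fin m) (i : Fin 8) :
    ¬ IsCycleVertex (k, isolatedPosition k i) := by
  simp only [IsCycleVertex, isolatedPosition]; omega

/-! ### Case distinctions for critical pairs, and the count -/

theorem shielded_side_side {k l : Fin m} {i j : Fin 16} (h : (k, i) ≠ (l, j)) :
    ∀ᶠ P in 𝓝 (basePoint m), Shielded P ((k, i), (k, i + 1)) ((l, j), (l, j + 1)) := by
  rcases lt_trichotomy k l with hkl | rfl | hkl
  · exact separated_side_side_of_lt hkl i j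
  · have step (k : Fin m) (i : Fin 16) : ∀ᶠ P in 𝓝 (basePoint m),
        Shielded P ((k, i), (k, i + 1)) ((k, i + 1), (k, i + 1 + 1)) := by
      have e : i + 1 - 1 = i := by grind
      by_cases hc : IsCycleVertex (k, i + 1)
      · have := shielded_side_side_at_cycleVertex k (i + 1) hc
        rw [e] at this
        exact this.mono fun P hP => hP.swap_left
      · have := shielded_side_side_at_not_cycleVertex k (i + 1) hc
        rw [e] at this
        exact this.mono fun P hP => hP.swap_left
    obtain ⟨d, rfl⟩ : ∃ d, j = i + d := ⟨j - i, by grind⟩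
    by_cases h0 : d = 0
    · subst h0; simp at h
    by_cases h1 : d = 1
    · subst h1; exact step k i
    by_cases h15 : d = 15
    · subst h15
      have := step k (i + 15)
      have e : i + 15 + 1 = i := by grind
      rw [e] at this ⊢
      exact this.mono fun P hP => hP.symm
    exact separated_side_side_of_eq k i d h0 h1 h15
  · exact (separated_side_side_of_lt hkl j i).mono fun P hP => hP.symm

theorem shielded_side_radial {k l i : Fin m} (hl : (l : ℕ) = k + 1) {j e : Fin 16}
    (hj : ¬ IsCycleVertex (k, j)) :
    ∀ᶠ P in 𝓝 (basePoint m), Shielded P ((i, e), (i, e + 1)) ((k, j), (l, j)) := by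
  obtain ⟨d, rfl⟩ : ∃ d, e = j + d := ⟨e - j, by grind⟩
  have e15 : j + 15 + 1 = j := by grind
  have e15' : j + 15 = j - 1 := by grind
  by_cases hik : i = k
  · subst hik
    by_cases h0 : d = 0
    · subst h0
      have hab : (alternatingGraph m).Adj (i, j + 1) (i, j - 1) :=
        adj_iff.2 ⟨rfl, isCycleVertex_add_one.2 hj, Or.inr (by grind)⟩
      simpa using shielded_side_radial_at_inner hl hab (Or.inr ⟨by grind, by grind⟩)
    by_cases h15 : d = 15
    · subst h15
      have hab : (alternatingGraph m).Adj (i, j - 1) (i, j + 1) :=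
        adj_iff.2 ⟨rfl, isCycleVertex_sub_one.2 hj, Or.inl (by grind)⟩
      have := shielded_side_radial_at_inner (j := j) hl hab (Or.inl ⟨by grind, by grind⟩)
      rw [e15, e15']
      exact this.mono fun P hP => hP.swap_left
    exact separated_side_radial_of_inner hl j d h0 h15
  by_cases hil : i = l
  · subst hil
    have hc := (isCycleVertex_succ hl).2 hj
    by_cases h0 : d = 0
    · subst h0
      have := shielded_side_radial_at_outer_add hl hc
      simp only [add_zero]
      exact this.mono fun P hP => hP.swap_left.symm
    by_cases h15 : d = 15
    · subst h15
      have := shielded_side_radial_at_outer_sub hl hc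
      rw [e15, e15']
      exact this.mono fun P hP => hP.swap_left.swap_right
    exact separated_side_radial_of_outer hl j d h0 h15
  exact separated_side_radial_of_far hl j (j + d) (by omega)

/-- Parity keeps radial pairs apart: between the same circles their directions differ by at least
two steps, and on successive annuli the directions differ, so no vertex is shared. -/
theorem shielded_radial_radial {k l i i' : Fin m} (hl : (l : ℕ) = k + 1) (hi : (i' : ℕ) = i + 1)
    {j e : Fin 16} (hj : ¬ IsCycleVertex (k, j)) (he : ¬ IsCycleVertex (i, e))
    (h : (k, j) ≠ (i, e)) :
    ∀ᶠ P in 𝓝 (basePoint m), Shielded P ((k, j), (l, j)) ((i, e), (i', e)) := by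
  wlog hki : k ≤ i generalizing k l i i' j e
  · exact (this hi hl he hj h.symm (by omega)).mono fun P hP => hP.symm
  obtain ⟨d, rfl⟩ : ∃ d, e = j + d := ⟨e - j, by grind⟩
  by_cases h1 : k = i
  · subst h1
    obtain rfl : i' = l := by omega
    refine separated_radial_radial_of_eq hl j d ?_ ?_ ?_
    · rintro rfl; simp at h
    · rintro rfl; exact he (isCycleVertex_add_one.2 hj)
    · rintro rfl
      rw [show j + 15 = j - 1 by grind] at he
      exact he (isCycleVertex_sub_one.2 hj)
  by_cases h2 : i = l
  · subst h2
    refine separated_radial_radial_of_succ hl hi j d ?_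
    rintro rfl
    rw [add_zero] at he
    exact he ((isCycleVertex_succ hl).2 hj)
  exact separated_radial_radial_of_far hl hi (by omega) j (j + d)

theorem eventually_shielded_criticalPair {p q : PairIndex m} (h : p ≠ q) :
    ∀ᶠ P in 𝓝 (basePoint m), Shielded P (criticalPair p) (criticalPair q) := by
  rcases p with v | ⟨k, i⟩ <;> rcases q with w | ⟨l, j⟩
  · exact shielded_side_side fun e => h (congrArg Sum.inl e)
  · exact shielded_side_radial rfl (not_isCycleVertex_isolatedPosition ⟨l, by omega⟩ j)
  · exact (shielded_side_radial rfl (not_isCycleVertex_isolatedPosition ⟨k, by omega⟩ i)).mono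
      fun P hP => hP.symm
  · refine shielded_radial_radial rfl rfl (not_isCycleVertex_isolatedPosition ⟨k, by omega⟩ i)
      (not_isCycleVertex_isolatedPosition ⟨l, by omega⟩ j) fun e => h ?_
    simp only [isolatedPosition, Prod.mk.injEq, Fin.mk.injEq] at e
    obtain ⟨e1, e2⟩ := e
    rw [show k = l from Fin.ext e1, show i = j from Fin.ext (by omega)]

theorem criticalPair_ne (p : PairIndex m) : (criticalPair p).1 ≠ (criticalPair p).2 := by
  rcases p with ⟨k, j⟩ | ⟨k, i⟩
  · intro h
    have : j = j + 1 := congrArg Prod.snd h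
    revert this
    exact (by decide : ∀ j : Fin 16, j ≠ j + 1) j
  · intro h
    have : (k : ℕ) = k + 1 := congrArg (fun v => (v.1 : ℕ)) h
    omega

theorem not_adj_criticalPair (p : PairIndex m) :
    ¬ (alternatingGraph m).Adj (criticalPair p).1 (criticalPair p).2 := by
  rw [adj_iff]
  rintro ⟨h1, -, h2⟩
  rcases p with ⟨k, j⟩ | ⟨k, i⟩
  · revert h2
    exact (by decide : ∀ j : Fin 16, ¬ (j + 1 = j + 2 ∨ j = j + 1 + 2)) j
  · have : (k : ℕ) = k + 1 := congrArg (fun v : Fin m => (v : ℕ)) h1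
    omega

/-- If the critical pairs shield each other, each of them needs a witness of its own. -/
theorem atLeastWitnessesNeeded_of_shielded (hm : 1 ≤ m) {P : CircleVertex m → Plane}
    (h : ∀ p q : PairIndex m, p ≠ q → Shielded P (criticalPair p) (criticalPair q)) :
    AtLeastWitnessesNeeded P (alternatingGraph m) (24 * m - 8) := by
  intro W hW
  have hex (p : PairIndex m) : ∃ x ∈ W, diamPower (P (criticalPair p).1) (P (criticalPair p).2) x ≤ 0
      ∧ x ≠ P (criticalPair p).1 ∧ x ≠ P (criticalPair p).2 := by
    have hn := not_adj_criticalPair p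
    rw [← hW] at hn
    have hne : ((W : Set Plane) ∩ (diametralDisk (P (criticalPair p).1) (P (criticalPair p).2) \
        {P (criticalPair p).1, P (criticalPair p).2})).Nonempty :=
      Set.nonempty_iff_ne_empty.2 fun he => hn ⟨criticalPair_ne p, he⟩
    obtain ⟨x, hxW, hx, hx'⟩ := hne
    simp only [Set.mem_insert_iff, Set.mem_singleton_iff, not_or] at hx'
    exact ⟨x, hxW, mem_diametralDisk.1 hx, hx'.1, hx'.2⟩
  choose f hfW hf hf1 hf2 using hex
  have hinj : Function.Injective f := by
    intro p q hpq
    by_contra hne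
    obtain ⟨a, b, hab, hx⟩ := h p q hne (f p) (hf p) (hf1 p) (hf2 p)
      (hpq ▸ hf q) (hpq ▸ hf1 q) (hpq ▸ hf2 q)
    rw [← hW] at hab
    have : f p ∈ (W : Set Plane) ∩ (diametralDisk (P a) (P b) \ {P a, P b}) :=
      ⟨hfW p, mem_diametralDisk_of_neg hx⟩
    rw [hab.2] at this
    exact this
  have hcard := Finset.card_le_card_of_injOn (s := Finset.univ) f (fun p _ => hfW p)
    hinj.injOn
  simp only [Finset.card_univ, Fintype.card_sum, Fintype.card_prod, Fintype.card_fin] at hcard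
  have : 24 * m ≤ W.card + 8 := by omega
  have : (24 * m : ℝ) ≤ W.card + 8 := by exact_mod_cast this
  linarith

/-! ### Points outside all disks of edges -/

/-- The point lies outside all closed disks over the edges. -/
def IsFree (m : ℕ) (x : Plane) : Prop :=
  ∀ u v, (alternatingGraph m).Adj u v → 0 < diamPower (basePoint m u) (basePoint m v) x

theorem diamPower_eq_dot (p q x : Plane) :
    diamPower p q x = dot x x - dot x p - dot x q + dot p q := by
  unfold diamPower dot; ring

theorem dot_smul_left (t : ℝ) (p q : Plane) : dot (t • p) q = t * dot p q := by
  simp [dot]; ring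

theorem dot_smul_right (t : ℝ) (p q : Plane) : dot p (t • q) = t * dot p q := by
  simp [dot]; ring

theorem dot_add_left (p q x : Plane) : dot (p + q) x = dot p x + dot q x := by
  simp [dot]; ring

theorem dot_add_right (p q x : Plane) : dot x (p + q) = dot x p + dot x q := by
  simp [dot]; ring

theorem isFree_iff {x : Plane} : IsFree m x ↔ ∀ (l : Fin m) (j : Fin 16), IsCycleVertex (l, j) →
    0 < diamPower (basePoint m (l, j)) (basePoint m (l, j + 2)) x := by
  constructor
  · exact fun h l j hj => h _ _ (adj_iff.2 ⟨rfl, hj, Or.inl rfl⟩)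
  · rintro h ⟨l, i⟩ ⟨l', j⟩ hadj
    obtain ⟨rfl, hi, e | e⟩ := adj_iff.1 hadj
    · obtain rfl : j = i + 2 := e
      exact h _ _ hi
    · obtain rfl : i = j + 2 := e
      rw [diamPower_comm]
      exact h _ _ (isCycleVertex_add_two.1 hi)

theorem sub_add_two_eq (j : Fin 16) : j - (j + 2) = 14 := by grind

/-- Points much closer to or farther from the centre than a circle avoid its edge disks. -/
theorem diamPower_pos_of_norm {l : Fin m} {j : Fin 16} {x : Plane}
    (h : dot x x ≤ (0.54 * rad l) ^ 2 ∨ (1.31 * rad l) ^ 2 ≤ dot x x) :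
    0 < diamPower (basePoint m (l, j)) (basePoint m (l, j + 2)) x := by
  have hr := rad_pos l
  obtain ⟨hc, hc'⟩ := c1_bounds
  obtain ⟨hc2, hc2'⟩ := c2_bounds
  have h1 := c1_sq
  have hx : 0 ≤ dot x x := by unfold dot; nlinarith [sq_nonneg (x 0), sq_nonneg (x 1)]
  set a := basePoint m (l, j) with ha
  set b := basePoint m (l, j + 2) with hb
  have haa : dot a a = rad l ^ 2 := by rw [ha, dot_base, sub_self, cosTable_values.1]; ring
  have hbb : dot b b = rad l ^ 2 := by rw [hb, dot_base, sub_self, cosTable_values.1]; ring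
  have hab : dot a b = rad l ^ 2 * c2 := by
    rw [ha, hb, dot_base]
    simp only [sub_add_two_eq, cosTable_values]; ring
  obtain ⟨s, hs0, hs⟩ : ∃ s : ℝ, 0 ≤ s ∧ s ^ 2 = dot x x :=
    ⟨√(dot x x), Real.sqrt_nonneg _, Real.sq_sqrt hx⟩
  -- Cauchy–Schwarz for `x` and `a + b`, whose norm is `2 * c1 * rad l`.
  have hcs : (dot x a + dot x b) ^ 2 ≤ (s * (2 * c1 * rad l)) ^ 2 := by
    have e : (s * (2 * c1 * rad l)) ^ 2 = dot x x * (dot a a + 2 * dot a b + dot b b) := by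
      rw [mul_pow, hs, haa, hbb, hab]; linear_combination 2 * dot x x * rad l ^ 2 * h1
    rw [e]
    unfold dot
    nlinarith [sq_nonneg (x 0 * (a 1 + b 1) - x 1 * (a 0 + b 0))]
  have hle := abs_le_of_sq_le_sq hcs (by positivity)
  have hle' := le_of_abs_le hle
  rw [diamPower_eq_dot, hab, ← hs]
  rw [← hs] at h
  have hsc : s * (2 * c1 * rad l) ≤ s * (2 * 0.9239 * rad l) := by gcongr
  have hrc := mul_lt_mul_of_pos_left hc2 (mul_pos hr hr)
  -- The edge disk has its centre at distance `c1` and radius `c3` (in units of `rad l`), so it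
  -- covers only distances from about 0.541 to 1.307.
  rcases h with h | h
  · have h' := (sq_le_sq₀ hs0 (by positivity)).1 h
    nlinarith [mul_nonneg (sub_nonneg.2 h') hr.le, mul_pos hr hr, sq_nonneg (0.54 * rad l - s)]
  · have h' := (sq_le_sq₀ (by positivity) hs0).1 h
    nlinarith [mul_nonneg (sub_nonneg.2 h') hr.le, mul_pos hr hr, sq_nonneg (1.31 * rad l - s)]

/-- The sum is 2 `c1` times the cosine of `d - 1` steps; for even `d` that is an odd number of
steps, so the cosine is at most `c1`. -/
theorem cosTable_add_le_of_even (d : Fin 16) (h : (d : ℕ) % 2 = 0) :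
    cosTable d + cosTable (d - 2) ≤ 1 + c2 := by
  obtain ⟨hc, hc'⟩ := c1_bounds
  obtain ⟨hc2, hc2'⟩ := c2_bounds
  obtain ⟨h3, hc3⟩ := c3_bounds
  revert d
  refine forall_fin16 ?_ ?_ ?_ ?_ ?_ ?_ ?_ ?_ ?_ ?_ ?_ ?_ ?_ ?_ ?_ ?_ <;> intro h <;>
    first | (exact absurd h (by decide)) | (simp only [Fin.reduceSub, cosTable_values]; linarith)

theorem cosTable_add_le (d : Fin 16) : cosTable d + cosTable (d - 2) ≤ 2 * c1 := by
  obtain ⟨hc, hc'⟩ := c1_bounds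
  obtain ⟨hc2, hc2'⟩ := c2_bounds
  obtain ⟨h3, hc3⟩ := c3_bounds
  revert d
  refine forall_fin16 ?_ ?_ ?_ ?_ ?_ ?_ ?_ ?_ ?_ ?_ ?_ ?_ ?_ ?_ ?_ ?_ <;>
    (simp only [Fin.reduceSub, cosTable_values]; linarith)

/-- Radial points in the direction of a cycle vertex. -/
theorem diamPower_smul_pos {k l : Fin m} {i j : Fin 16} (hij : (i : ℕ) % 2 = (j : ℕ) % 2) {t : ℝ}
    (ht : 0 < t) (h : rad l < t * rad k ∨ t * rad k < c2 * rad l) :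
    0 < diamPower (basePoint m (l, j)) (basePoint m (l, j + 2)) (t • basePoint m (k, i)) := by
  have hk := rad_pos k
  have hr := rad_pos l
  obtain ⟨hc2, hc2'⟩ := c2_bounds
  have e : i - (j + 2) = i - j - 2 := by grind
  have hd := cosTable_add_le_of_even (i - j) (by rw [Fin.val_sub]; omega)
  simp only [diamPower_eq_dot, dot_smul_left, dot_smul_right, dot_base, sub_self, sub_add_two_eq,
    cosTable_values, e]
  have hz := mul_pos ht hk
  have := mul_le_mul_of_nonneg_left hd (mul_pos hz hr).le
  have hcr : c2 * rad l < rad l := by nlinarith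
  -- This product bounds the power from below: along a ray through a cycle vertex, edge disks cover
  -- only distances from `c2 * rad l` to `rad l`.
  have : 0 < (t * rad k - rad l) * (t * rad k - c2 * rad l) := by
    rcases h with h | h
    · exact mul_pos (by linarith) (by linarith)
    · exact mul_pos_of_neg_of_neg (by linarith) (by linarith)
  nlinarith

theorem dot_smul_base_self (t : ℝ) (v : CircleVertex m) :
    dot (t • basePoint m v) (t • basePoint m v) = (t * rad v.1) ^ 2 := by
  rw [dot_smul_left, dot_smul_right, dot_base, sub_self, cosTable_values.1]; ring

theorem isFree_smul_cycleVertex {v : CircleVertex m} (hv : IsCycleVertex v) {t : ℝ} (h1 : 1 < t)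
    (h2 : t ≤ 1.01) : IsFree m (t • basePoint m v) := by
  obtain ⟨k, i⟩ := v
  rw [isFree_iff]
  intro l j hj
  have hk := rad_pos k
  have hl := rad_pos l
  rcases lt_trichotomy k l with h | rfl | h
  · have := rad_lt (show (k : ℕ) < l from h)
    refine diamPower_pos_of_norm (Or.inl ?_)
    rw [dot_smul_base_self]
    exact pow_le_pow_left₀ (by positivity) (by simp only; nlinarith) 2
  · refine diamPower_smul_pos (by simp only [IsCycleVertex] at *; omega) (by linarith) (Or.inl ?_)
    nlinarith
  · have := rad_lt (show (l : ℕ) < k from h)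
    refine diamPower_pos_of_norm (Or.inr ?_)
    rw [dot_smul_base_self]
    exact pow_le_pow_left₀ (by positivity) (by simp only; nlinarith) 2

/-- The points between consecutive circles that lie outside all disks of edges. -/
theorem isFree_smul_isolatedVertex {v : CircleVertex m} (hv : ¬ IsCycleVertex v) :
    IsFree m ((1.32 : ℝ) • basePoint m v) := by
  obtain ⟨k, i⟩ := v
  rw [isFree_iff]
  intro l j hj
  have hk := rad_pos k
  have hl := rad_pos l
  rcases le_or_gt l k with h | h
  · have := rad_mono (show (l : ℕ) ≤ k from h)
    refine diamPower_pos_of_norm (Or.inr ?_)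
    rw [dot_smul_base_self]
    exact pow_le_pow_left₀ (by positivity) (by simp only; linarith) 2
  by_cases h1 : (l : ℕ) = k + 1
  -- The factor 1.32 fits between 1.31, where the disks of the own circle have ended, and 1.9 `c2` ≈
  -- 1.343, where those of the next begin in this direction.
  · refine diamPower_smul_pos (by simp only [IsCycleVertex] at *; omega) (by norm_num) (Or.inr ?_)
    have := c2_bounds.1
    rw [h1, rad_succ]
    nlinarith
  · have h3 := rad_lt (show (k : ℕ) + 1 < l by omega)
    rw [rad_succ] at h3
    refine diamPower_pos_of_norm (Or.inl ?_)
    rw [dot_smul_base_self]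
    exact pow_le_pow_left₀ (by positivity) (by simp only; linarith) 2

theorem isFree_zero : IsFree m 0 := by
  rw [isFree_iff]
  intro l j hj
  refine diamPower_pos_of_norm (Or.inl ?_)
  have hl := rad_pos l
  have : dot (0 : Plane) 0 = 0 := by simp [dot]
  rw [this]
  positivity

/-- A free point in the disk over a cycle vertex and a vertex next to it on the same circle. -/
theorem exists_isFree_side {k : Fin m} {i i' : Fin 16} (hi : IsCycleVertex (k, i))
    (h : i - i' = 1 ∨ i - i' = 15) :
    ∃ x, IsFree m x ∧ diamPower (basePoint m (k, i)) (basePoint m (k, i')) x < 0 := by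
  have hk := rad_pos k
  have hkk := mul_pos hk hk
  obtain ⟨hc, hc'⟩ := c1_bounds
  obtain ⟨hc2, hc2'⟩ := c2_bounds
  have h' : cosTable (i - i') = c1 ∧ cosTable (i' - i) = c1 := by
    rcases h with h | h
    · simp only [h, show i' - i = 15 by grind, cosTable_values, and_self]
    · simp only [h, show i' - i = 1 by grind, cosTable_values, and_self]
  obtain ⟨e1, e2⟩ := h'
  -- Leaving the cycle vertex at an angle between π/16 and π/8 from the outward radius, towards the
  -- other vertex, enters the side's disk and avoids both edge disks there. The constants give a
  -- short step at about 16.7°, near the middle of this range.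
  set x : Plane := (1.0055 : ℝ) • basePoint m (k, i) + (0.0157 : ℝ) • basePoint m (k, i') with hx
  have hxx : dot x x = rad k * rad k * (1.0055 ^ 2 + 0.0157 ^ 2 + 2 * 1.0055 * 0.0157 * c1) := by
    simp only [hx, dot_add_left, dot_add_right, dot_smul_left, dot_smul_right, dot_base, sub_self,
      e1, e2, cosTable_values.1]
    ring
  have hlow : rad k ^ 2 ≤ dot x x := by rw [hxx]; nlinarith
  have hupp : dot x x ≤ (1.022 * rad k) ^ 2 := by rw [hxx]; nlinarith
  refine ⟨x, ?_, ?_⟩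
  · rw [isFree_iff]
    intro l j hj
    have hl := rad_pos l
    rcases lt_trichotomy k l with h | rfl | h
    · have := rad_lt (show (k : ℕ) < l from h)
      refine diamPower_pos_of_norm (Or.inl (hupp.trans ?_))
      exact pow_le_pow_left₀ (by positivity) (by linarith) 2
    · rw [diamPower_eq_dot, hxx]
      have e : i - (j + 2) = i - j - 2 := by grind
      have e' : i' - (j + 2) = i' - j - 2 := by grind
      simp only [hx, dot_add_left, dot_smul_left, dot_base, e, e', sub_add_two_eq, cosTable_values]
      have h1 := cosTable_add_le_of_even (i - j) (by
        rw [Fin.val_sub]; simp only [IsCycleVertex] at *; omega)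
      have h2 := cosTable_add_le (i' - j)
      have h1' := mul_le_mul_of_nonneg_left h1 hkk.le
      have h2' := mul_le_mul_of_nonneg_left h2 hkk.le
      have h3 := mul_lt_mul_of_pos_left hc2' hkk
      have h4 := mul_lt_mul_of_pos_left hc hkk
      nlinarith
    · have := rad_lt (show (l : ℕ) < k from h)
      refine diamPower_pos_of_norm (Or.inr (le_trans ?_ hlow))
      exact pow_le_pow_left₀ (by positivity) (by linarith) 2
  · rw [diamPower_eq_dot, hxx]
    simp only [hx, dot_add_left, dot_smul_left, dot_base, e1, e2, sub_self, cosTable_values.1]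
    have h3 := mul_lt_mul_of_pos_left hc hkk
    have h4 := mul_lt_mul_of_pos_left hc' hkk
    nlinarith

/-! ### Every non-edge has a free point in its open disk -/

theorem exists_near_one {f : ℝ → ℝ} (hf : Continuous f) (h : f 1 < 0) :
    ∃ t, 1 < t ∧ t ≤ 1.01 ∧ f t < 0 := by
  have h1 : ∀ᶠ t in 𝓝[>] (1 : ℝ), f t < 0 :=
    (hf.continuousAt.eventually_lt_const h).filter_mono nhdsWithin_le_nhds
  have h2 : ∀ᶠ t in 𝓝[>] (1 : ℝ), t ∈ Set.Ioo (1 : ℝ) 1.01 :=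
    Ioo_mem_nhdsGT (by norm_num)
  obtain ⟨t, ht, ht'⟩ := (h1.and h2).exists
  exact ⟨t, ht'.1, ht'.2.le, ht⟩

theorem exists_isFree_of_cycleVertex {u v w : CircleVertex m} (hw : IsCycleVertex w)
    (h : diamPower (basePoint m u) (basePoint m v) (basePoint m w) < 0) :
    ∃ x, IsFree m x ∧ diamPower (basePoint m u) (basePoint m v) x < 0 := by
  obtain ⟨t, h1, h2, h3⟩ := exists_near_one
    (f := fun t => diamPower (basePoint m u) (basePoint m v) (t • basePoint m w))
    (by unfold diamPower; simp only [PiLp.smul_apply, smul_eq_mul]; fun_prop) (by simpa using h)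
  exact ⟨_, isFree_smul_cycleVertex hw h1 h2, h3⟩

/-- The vertex `u` is on the boundary of the disk, and the hypothesis says that the outward ray at
`u` enters it. -/
theorem exists_isFree_of_outward {u v : CircleVertex m} (hu : IsCycleVertex u)
    (h : dot (basePoint m u) (basePoint m u) < dot (basePoint m u) (basePoint m v)) :
    ∃ x, IsFree m x ∧ diamPower (basePoint m u) (basePoint m v) x < 0 := by
  obtain ⟨t, h1, h2, h3⟩ := exists_near_one
    (f := fun t => t * dot (basePoint m u) (basePoint m u) - dot (basePoint m u) (basePoint m v))
    (by fun_prop) (by linarith)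
  refine ⟨_, isFree_smul_cycleVertex hu h1 h2, ?_⟩
  simp only [diamPower_eq_dot, dot_smul_left, dot_smul_right]
  nlinarith

/-- From a cycle vertex, directions at most one step off are handled by the outward ray. From an
isolated vertex, the same direction uses the gap point. Otherwise a nearest other cycle vertex of
the inner circle lies inside the disk. -/
theorem exists_isFree_of_lt {k l : Fin m} (hkl : k < l) (i d : Fin 16) :
    ∃ x, IsFree m x ∧ diamPower (basePoint m (k, i)) (basePoint m (l, i + d)) x < 0 := by
  have hk := rad_pos k
  have hl := rad_lt (show (k : ℕ) < l from hkl)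
  have hkk := mul_pos hk hk
  have hkl' := mul_le_mul_of_nonneg_left hl hk.le
  obtain ⟨hc, hc'⟩ := c1_bounds
  obtain ⟨hc2, hc2'⟩ := c2_bounds
  obtain ⟨h3, hc3⟩ := c3_bounds
  have e1 : i - (i + d) = 0 - d := by grind
  have outward (hi : IsCycleVertex (k, i)) (h : 0.9 < cosTable (0 - d)) :
      ∃ x, IsFree m x ∧ diamPower (basePoint m (k, i)) (basePoint m (l, i + d)) x < 0 := by
    apply exists_isFree_of_outward hi
    simp only [dot_base, e1, sub_self, cosTable_values.1]
    nlinarith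
  have inside (e : Fin 16) (he : IsCycleVertex (k, i + e))
      (h : 0 < cosTable (e - d) - cosTable (0 - d))
      (h' : 1 - cosTable e < 1.9 * (cosTable (e - d) - cosTable (0 - d))) :
      ∃ x, IsFree m x ∧ diamPower (basePoint m (k, i)) (basePoint m (l, i + d)) x < 0 := by
    apply exists_isFree_of_cycleVertex he
    have e2 : i + e - i = e := by grind
    have e3 : i + e - (i + d) = e - d := by grind
    simp only [diamPower_eq_dot, dot_base, e1, e2, e3, sub_self, cosTable_values.1]
    nlinarith [mul_lt_mul_of_pos_left h' hkk, mul_le_mul_of_nonneg_right hkl' h.le]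
  by_cases hi : IsCycleVertex (k, i)
  · have p2 := inside 2 (isCycleVertex_add_two.2 hi)
    have p14 := inside 14 (by
      have : i + 14 + 2 = i := by grind
      rw [← isCycleVertex_add_two, this]; exact hi)
    have po := outward hi
    clear inside outward e1
    revert d
    refine forall_fin16 ?_ ?_ ?_ ?_ ?_ ?_ ?_ ?_ ?_ ?_ ?_ ?_ ?_ ?_ ?_ ?_ <;> intro p2 p14 po <;>
      simp only [Fin.reduceSub, cosTable_values] at p2 p14 po <;>
      first
        | exact po (by linarith)
        | exact p2 (by linarith) (by linarith)
        | exact p14 (by linarith) (by linarith)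
  · by_cases hd : d = 0
    · subst hd
      refine ⟨_, isFree_smul_isolatedVertex hi, ?_⟩
      simp only [diamPower_eq_dot, dot_smul_left, dot_smul_right, dot_base, e1, sub_self,
        cosTable_values.1]
      nlinarith
    have p1 := inside 1 (isCycleVertex_add_one.2 hi)
    have p15 := inside 15 (by
      rw [show i + 15 = i - 1 by grind]; exact isCycleVertex_sub_one.2 hi)
    clear inside outward e1
    revert d
    refine forall_fin16 ?_ ?_ ?_ ?_ ?_ ?_ ?_ ?_ ?_ ?_ ?_ ?_ ?_ ?_ ?_ ?_ <;> intro hd p1 p15 <;>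
      simp only [Fin.reduceSub, cosTable_values] at p1 p15 <;>
      first
        | contradiction
        | exact p1 (by linarith) (by linarith)
        | exact p15 (by linarith) (by linarith)

/-- By Thales, a cycle vertex on the shorter arc lies inside the disk. Antipodal pairs have only the
boundary there and use the centre; sides have no vertex between them. -/
theorem exists_isFree_of_eq {k : Fin m} {i d : Fin 16} (hd : d ≠ 0)
    (hadj : ¬ (alternatingGraph m).Adj (k, i) (k, i + d)) :
    ∃ x, IsFree m x ∧ diamPower (basePoint m (k, i)) (basePoint m (k, i + d)) x < 0 := by
  have hk := rad_pos k
  have hkk := mul_pos hk hk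
  obtain ⟨hc, hc'⟩ := c1_bounds
  obtain ⟨hc2, hc2'⟩ := c2_bounds
  obtain ⟨h3, hc3⟩ := c3_bounds
  have e1 : i - (i + d) = 0 - d := by grind
  have next (h : d = 1 ∨ d = 15) :
      ∃ x, IsFree m x ∧ diamPower (basePoint m (k, i)) (basePoint m (k, i + d)) x < 0 := by
    by_cases hi : IsCycleVertex (k, i)
    · exact exists_isFree_side hi (by rw [e1]; rcases h with rfl | rfl <;> decide)
    · have hi' : IsCycleVertex (k, i + d) := by
        rcases h with rfl | rfl
        · exact isCycleVertex_add_one.2 hi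
        · rw [show i + 15 = i - 1 by grind]; exact isCycleVertex_sub_one.2 hi
      simp only [diamPower_comm (basePoint m (k, i))]
      exact exists_isFree_side hi' (by rwa [show i + d - i = d by grind])
  have opposite (h : d = 8) :
      ∃ x, IsFree m x ∧ diamPower (basePoint m (k, i)) (basePoint m (k, i + d)) x < 0 := by
    refine ⟨0, isFree_zero, ?_⟩
    have hz (p : Plane) : dot 0 p = 0 := by simp [dot]
    have e8 : i - (i + d) = 8 := by rw [e1, h]; decide
    simp only [diamPower_eq_dot, hz, dot_base, e8, cosTable_values]
    linarith
  have inside (e : Fin 16) (he : IsCycleVertex (k, i + e))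
      (h : 1 - cosTable e < cosTable (e - d) - cosTable (0 - d)) :
      ∃ x, IsFree m x ∧ diamPower (basePoint m (k, i)) (basePoint m (k, i + d)) x < 0 := by
    apply exists_isFree_of_cycleVertex he
    have e2 : i + e - i = e := by grind
    have e3 : i + e - (i + d) = e - d := by grind
    simp only [diamPower_eq_dot, dot_base, e1, e2, e3, sub_self, cosTable_values.1]
    nlinarith [mul_lt_mul_of_pos_left h hkk]
  by_cases hi : IsCycleVertex (k, i)
  · have h2 : d ≠ 2 := fun h => hadj (adj_iff.2 ⟨rfl, hi, Or.inl (by rw [h])⟩)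
    have h14 : d ≠ 14 := fun h => hadj (adj_iff.2 ⟨rfl, hi, Or.inr (by rw [h]; grind)⟩)
    have p2 := inside 2 (isCycleVertex_add_two.2 hi)
    have p14 := inside 14 (by
      have : i + 14 + 2 = i := by grind
      rw [← isCycleVertex_add_two, this]; exact hi)
    clear inside e1 hadj
    revert d
    refine @forall_fin16 _ ?_ ?_ ?_ ?_ ?_ ?_ ?_ ?_ ?_ ?_ ?_ ?_ ?_ ?_ ?_ ?_ <;>
      intro hd next opposite h2 h14 p2 p14 <;>
      simp only [Fin.reduceSub, cosTable_values] at p2 p14 <;>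
      first
        | contradiction
        | exact next (by decide)
        | exact opposite rfl
        | exact p2 (by linarith)
        | exact p14 (by linarith)
  · have p1 := inside 1 (isCycleVertex_add_one.2 hi)
    have p15 := inside 15 (by
      rw [show i + 15 = i - 1 by grind]; exact isCycleVertex_sub_one.2 hi)
    clear inside e1 hadj
    revert d
    refine @forall_fin16 _ ?_ ?_ ?_ ?_ ?_ ?_ ?_ ?_ ?_ ?_ ?_ ?_ ?_ ?_ ?_ ?_ <;>
      intro hd next opposite p1 p15 <;>
      simp only [Fin.reduceSub, cosTable_values] at p1 p15 <;>
      first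
        | contradiction
        | exact next (by decide)
        | exact opposite rfl
        | exact p1 (by linarith)
        | exact p15 (by linarith)

theorem exists_isFree_of_not_adj {u v : CircleVertex m} (huv : u ≠ v)
    (hadj : ¬ (alternatingGraph m).Adj u v) :
    ∃ x, IsFree m x ∧ diamPower (basePoint m u) (basePoint m v) x < 0 := by
  obtain ⟨k, i⟩ := u
  obtain ⟨l, j⟩ := v
  have hj : j = i + (j - i) := by grind
  have hi : i = j + (i - j) := by grind
  rcases lt_trichotomy k l with h | rfl | h
  · rw [hj]; exact exists_isFree_of_lt h _ _
  · rw [hj] at hadj huv ⊢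
    refine exists_isFree_of_eq (fun h => huv ?_) hadj
    rw [h, add_zero]
  · rw [hi]
    simp only [diamPower_comm (basePoint m (k, j + (i - j)))]
    exact exists_isFree_of_lt h _ _

/-! ### Moving points into general position -/

theorem volume_affineSpan_pair (p q : Plane) :
    volume ((affineSpan ℝ {p, q} : AffineSubspace ℝ Plane) : Set Plane) = 0 := by
  apply Measure.addHaar_affineSubspace
  intro h
  have h1 : Module.finrank ℝ (affineSpan ℝ {p, q} : AffineSubspace ℝ Plane).direction ≤ 1 := by
    rw [direction_affineSpan]
    exact collinear_iff_finrank_le_one.1 (collinear_pair ℝ p q)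
  rw [h, AffineSubspace.direction_top, finrank_top, finrank_euclideanSpace_fin] at h1
  omega

/-- Circles with different centres share at most two points, so the set lies on one circle, or is
empty. -/
theorem volume_setOf_cospherical {p q r : Plane} (hpq : p ≠ q) (hpr : p ≠ r) (hqr : q ≠ r) :
    volume {x : Plane | EuclideanGeometry.Cospherical {x, p, q, r}} = 0 := by
  by_cases hne : ∃ x : Plane, EuclideanGeometry.Cospherical {x, p, q, r}
  · obtain ⟨x, c, R, hx⟩ := hne
    refine measure_mono_null ?_ (Measure.addHaar_sphere volume c R)
    rintro y ⟨c', R', hy⟩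
    have hcc : c' = c := by
      by_contra hcc
      rcases EuclideanGeometry.eq_of_dist_eq_of_dist_eq_of_finrank_eq_two (V := Plane)
        finrank_euclideanSpace_fin hcc hpq (hy p (by simp)) (hy q (by simp)) (hy r (by simp))
        (hx p (by simp)) (hx q (by simp)) (hx r (by simp)) with h | h
      · exact hpr h.symm
      · exact hqr h.symm
    subst hcc
    rw [mem_sphere_iff_norm, ← dist_eq_norm, hy y (by simp), ← hy p (by simp), hx p (by simp)]
  · push Not at hne
    simp [hne]

theorem exists_insert_inGeneralPosition {S : Finset Plane} (hS : InGeneralPosition (S : Set Plane))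
    (x₀ : Plane) {ε : ℝ} (hε : 0 < ε) :
    ∃ x, dist x x₀ < ε ∧ x ∉ S ∧ InGeneralPosition (insert x (S : Set Plane)) := by
  let bad : Set Plane := (S : Set Plane) ∪
    (⋃ p ∈ S, ⋃ q ∈ S, ((affineSpan ℝ {p, q} : AffineSubspace ℝ Plane) : Set Plane)) ∪
    ⋃ p ∈ S, ⋃ q ∈ S, ⋃ r ∈ S,
      {x : Plane | p ≠ q ∧ p ≠ r ∧ q ≠ r ∧ EuclideanGeometry.Cospherical {x, p, q, r}}
  have hbad : volume bad = 0 := by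
    refine measure_union_null (measure_union_null (S.measure_zero _) ?_) ?_
    · simp only [measure_biUnion_null_iff S.countable_toSet, ← Finset.mem_coe]
      exact fun p _ q _ => volume_affineSpan_pair p q
    · simp only [measure_biUnion_null_iff S.countable_toSet, ← Finset.mem_coe]
      intro p _ q _ r _
      by_cases h : p ≠ q ∧ p ≠ r ∧ q ≠ r
      · exact measure_mono_null (fun x hx => hx.2.2.2) (volume_setOf_cospherical h.1 h.2.1 h.2.2)
      · convert measure_empty (μ := (volume : Measure Plane))
        ext x
        simp only [Set.mem_ofPred_eq, Set.mem_empty_iff_false, iff_false]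
        tauto
  obtain ⟨x, hx, hxbad⟩ : ∃ x ∈ Metric.ball x₀ ε, x ∉ bad := by
    by_contra h
    push Not at h
    exact (Metric.measure_ball_pos volume x₀ hε).ne' (measure_mono_null h hbad)
  simp only [bad, Set.mem_union, Set.mem_iUnion, not_or, not_exists, Finset.mem_coe] at hxbad
  obtain ⟨⟨hxS, hline⟩, hcirc⟩ := hxbad
  refine ⟨x, hx, hxS, ?_, ?_⟩
  · intro T hT hcard hcol
    by_cases hxT : x ∈ T
    · obtain ⟨p, q, hpq, he⟩ := Finset.card_eq_two.1
        (show (T.erase x).card = 2 by rw [Finset.card_erase_of_mem hxT, hcard])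
      have hsub : ∀ y ∈ T.erase x, y ∈ S ∧ y ∈ T := fun y hy =>
        ⟨((hT (Finset.mem_of_mem_erase hy)).resolve_left (Finset.ne_of_mem_erase hy)),
          Finset.mem_of_mem_erase hy⟩
      rw [he] at hsub
      obtain ⟨hpS, hpT⟩ := hsub p (by simp)
      obtain ⟨hqS, hqT⟩ := hsub q (by simp)
      exact hline p hpS q hqS (hcol.mem_affineSpan_of_mem_of_ne hpT hqT hxT hpq)
    · exact hS.1 T (fun y hy => (hT hy).resolve_left (by rintro rfl; exact hxT hy)) hcard hcol
  · intro T hT hcard hcos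
    by_cases hxT : x ∈ T
    · obtain ⟨p, q, r, hpq, hpr, hqr, he⟩ := Finset.card_eq_three.1
        (show (T.erase x).card = 3 by rw [Finset.card_erase_of_mem hxT, hcard])
      have hsub : ∀ y ∈ T.erase x, y ∈ S := fun y hy =>
        ((hT (Finset.mem_of_mem_erase hy)).resolve_left (Finset.ne_of_mem_erase hy))
      have hT' : T = {x, p, q, r} := by rw [← Finset.insert_erase hxT, he]
      rw [he] at hsub
      refine hcirc p (hsub p (by simp)) q (hsub q (by simp)) r (hsub r (by simp))
        ⟨hpq, hpr, hqr, ?_⟩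
      rw [hT'] at hcos
      simpa using hcos
    · exact hS.2 T (fun y hy => (hT hy).resolve_left (by rintro rfl; exact hxT hy)) hcard hcos

theorem exists_inGeneralPosition_near {ι : Type*} [Finite ι] (Q₀ : ι → Plane) {ε : ℝ}
    (hε : 0 < ε) : ∃ Q : ι → Plane, (∀ i, dist (Q i) (Q₀ i) < ε) ∧ Function.Injective Q ∧
      InGeneralPosition (Set.range Q) := by
  classical
  have := Fintype.ofFinite ι
  have key (s : Finset ι) : ∃ Q : ι → Plane, (∀ i, dist (Q i) (Q₀ i) < ε) ∧ Set.InjOn Q s ∧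
      InGeneralPosition ((s.image Q : Finset Plane) : Set Plane) := by
    induction s using Finset.induction_on with
    | empty =>
      refine ⟨Q₀, fun i => by simpa using hε, by simp, ?_, ?_⟩ <;>
      · intro T hT hcard
        have : T = ∅ := by simpa using hT
        simp [this] at hcard
    | insert a s ha ih =>
      obtain ⟨Q, h1, h2, h3⟩ := ih
      obtain ⟨x, hx, hxs, hgp⟩ := exists_insert_inGeneralPosition h3 (Q₀ a) hε
      have hagree : ∀ i ∈ s, Function.update Q a x i = Q i := fun i hi =>
        Function.update_of_ne (by rintro rfl; exact ha hi) _ _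
      have himage : s.image (Function.update Q a x) = s.image Q := Finset.image_congr hagree
      refine ⟨Function.update Q a x, fun i => ?_, ?_, ?_⟩
      · by_cases hi : i = a
        · subst hi; simpa using hx
        · simpa [hi] using h1 i
      · rw [Finset.coe_insert, Set.injOn_insert (by simpa using ha)]
        refine ⟨h2.congr fun i hi => (hagree i hi).symm, ?_⟩
        rw [Function.update_self, ← Finset.coe_image, himage]
        simpa using hxs
      · rw [Finset.image_insert, himage, Function.update_self, Finset.coe_insert]
        exact hgp
  obtain ⟨Q, h1, h2, h3⟩ := key Finset.univ
  refine ⟨Q, h1, by simpa using h2, ?_⟩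
  simpa using h3

/-! ### The main theorem -/

/-- The pairs of distinct vertices that are not joined by an edge. -/
abbrev NonEdge (m : ℕ) : Type :=
  {p : CircleVertex m × CircleVertex m // p.1 ≠ p.2 ∧ ¬ (alternatingGraph m).Adj p.1 p.2}

/-- One witness in the disk of each non-edge and outside all disks of edges realize the graph. -/
theorem witnessGabrielGraph_eq {P : CircleVertex m → Plane} {w : NonEdge m → Plane}
    (h1 : ∀ p : NonEdge m, diamPower (P p.1.1) (P p.1.2) (w p) < 0)
    (h2 : ∀ p : NonEdge m, ∀ u v, (alternatingGraph m).Adj u v →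
      0 < diamPower (P u) (P v) (w p)) :
    witnessGabrielGraph P (Set.range w) = alternatingGraph m := by
  ext u v
  constructor
  · rintro ⟨huv, he⟩
    by_contra hadj
    have : w ⟨(u, v), huv, hadj⟩ ∈ Set.range w ∩ (diametralDisk (P u) (P v) \ {P u, P v}) :=
      ⟨⟨_, rfl⟩, mem_diametralDisk_of_neg (h1 ⟨(u, v), huv, hadj⟩)⟩
    rw [he] at this
    exact this
  · intro hadj
    refine ⟨hadj.ne, ?_⟩
    rw [Set.eq_empty_iff_forall_notMem]
    rintro _ ⟨⟨p, rfl⟩, hx, -⟩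
    exact (h2 p u v hadj).not_ge (mem_diametralDisk.1 hx)

theorem eventually_atLeastWitnessesNeeded (hm : 1 ≤ m) :
    ∀ᶠ P in 𝓝 (basePoint m), AtLeastWitnessesNeeded P (alternatingGraph m) (24 * m - 8) := by
  have h : ∀ᶠ P in 𝓝 (basePoint m), ∀ p q : PairIndex m, p ≠ q →
      Shielded P (criticalPair p) (criticalPair q) := by
    simp only [eventually_all]
    exact fun p q h => eventually_shielded_criticalPair h
  exact h.mono fun P hP => atLeastWitnessesNeeded_of_shielded hm hP

theorem edgeSet_nonempty (hm : 1 ≤ m) : (alternatingGraph m).edgeSet.Nonempty :=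
  ⟨s((⟨0, hm⟩, 0), (⟨0, hm⟩, 2)), adj_iff.2 ⟨rfl, rfl, Or.inl rfl⟩⟩

theorem exists_perturbation (hm : 1 ≤ m) {w : NonEdge m → Plane}
    (h1 : ∀ p : NonEdge m, diamPower (basePoint m p.1.1) (basePoint m p.1.2) (w p) < 0)
    (h2 : ∀ p, IsFree m (w p)) {ε : ℝ} (hε : 0 < ε) :
    ∃ P : CircleVertex m → Plane, Function.Injective P ∧ (∀ v, dist (P v) (basePoint m v) < ε) ∧
      (∃ W : Finset Plane, InGeneralPosition (Set.range P ∪ (W : Set Plane)) ∧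
        witnessGabrielGraph P (W : Set Plane) = alternatingGraph m) ∧
      AtLeastWitnessesNeeded P (alternatingGraph m) (24 * m - 8) := by
  classical
  -- Vertices and witnesses form one configuration, so that a single perturbation puts their union
  -- into general position.
  set Q₀ : CircleVertex m ⊕ NonEdge m → Plane := Sum.elim (basePoint m) w with hQ₀
  have hc : ContinuousAt (fun (Q : CircleVertex m ⊕ NonEdge m → Plane) v => Q (Sum.inl v)) Q₀ :=
    (continuous_pi fun v => continuous_apply (Sum.inl v)).continuousAt
  have e1 : ∀ᶠ Q in 𝓝 Q₀, AtLeastWitnessesNeeded (fun v => Q (Sum.inl v)) (alternatingGraph m)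
      (24 * m - 8) := hc.eventually (eventually_atLeastWitnessesNeeded hm)
  have e2 : ∀ᶠ Q in 𝓝 Q₀, ∀ p : NonEdge m,
      diamPower (Q (Sum.inl p.1.1)) (Q (Sum.inl p.1.2)) (Q (Sum.inr p)) < 0 := by
    rw [eventually_all]
    intro p
    exact eventually_lt_of_continuous (f := fun Q : CircleVertex m ⊕ NonEdge m → Plane =>
      diamPower (Q (Sum.inl p.1.1)) (Q (Sum.inl p.1.2)) (Q (Sum.inr p))) (g := fun _ => 0) (h1 p)
      (by unfold diamPower; fun_prop) (by fun_prop)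
  have e3 : ∀ᶠ Q in 𝓝 Q₀, ∀ p : NonEdge m, ∀ u v, (alternatingGraph m).Adj u v →
      0 < diamPower (Q (Sum.inl u)) (Q (Sum.inl v)) (Q (Sum.inr p)) := by
    simp only [eventually_all]
    intro p u v huv
    exact eventually_lt_of_continuous (f := fun _ => 0)
      (g := fun Q : CircleVertex m ⊕ NonEdge m → Plane =>
      diamPower (Q (Sum.inl u)) (Q (Sum.inl v)) (Q (Sum.inr p))) (h2 p u v huv)
      (by fun_prop) (by unfold diamPower; fun_prop)
  obtain ⟨δ, hδ, hall⟩ := Metric.eventually_nhds_iff.1 (e1.and (e2.and e3))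
  obtain ⟨Q, hQ, hinj, hgp⟩ := exists_inGeneralPosition_near Q₀ (lt_min hδ hε)
  obtain ⟨g1, g2, g3⟩ := hall
    ((dist_pi_lt_iff hδ).2 fun i => (hQ i).trans_le (min_le_left _ _))
  refine ⟨fun v => Q (Sum.inl v), hinj.comp Sum.inl_injective,
    fun v => (hQ (Sum.inl v)).trans_le (min_le_right _ _),
    ⟨Finset.univ.image fun p => Q (Sum.inr p), ?_, ?_⟩, g1⟩
  · rw [Finset.coe_image, Finset.coe_univ, Set.image_univ]
    convert hgp
    ext x; simp
  · rw [Finset.coe_image, Finset.coe_univ, Set.image_univ]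
    exact witnessGabrielGraph_eq g2 g3

end GabrielWitnesses

theorem mainTheorem5 (m : ℕ) (hm : 1 ≤ m) (n : ℕ) (hn : n = Fintype.card (CircleVertex m)) :
    (alternatingGraph m).edgeSet.Nonempty ∧
    ∃ r : ℕ → ℝ,
      (∀ k, 0 < r k ∧ (1.82 : ℝ) < r (k + 1) / r k ∧ r (k + 1) / r k < (1.92 : ℝ)) ∧
      -- the evenly spaced points themselves
      ((∃ W : Finset Plane,
          witnessGabrielGraph (concentricPoint m r) (W : Set Plane) = alternatingGraph m) ∧
        AtLeastWitnessesNeeded (concentricPoint m r) (alternatingGraph m)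
          ((3 / 2 : ℝ) * n - 8)) ∧
      -- arbitrarily small perturbations of them, with points and witnesses in general position
      (∀ ε : ℝ, 0 < ε → ∃ P : CircleVertex m → Plane,
        Function.Injective P ∧
        (∀ v, dist (P v) (concentricPoint m r v) < ε) ∧
        (∃ W : Finset Plane,
          InGeneralPosition (Set.range P ∪ (W : Set Plane)) ∧
          witnessGabrielGraph P (W : Set Plane) = alternatingGraph m) ∧
        AtLeastWitnessesNeeded P (alternatingGraph m) ((3 / 2 : ℝ) * n - 8)) := by
  classical
  have hn' : (3 / 2 : ℝ) * n - 8 = 24 * m - 8 := by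
    rw [hn]; simp; ring
  rw [hn']
  have hw (p : NonEdge m) := exists_isFree_of_not_adj p.2.1 p.2.2
  choose w hw1 hw2 using hw
  refine ⟨edgeSet_nonempty hm, rad, fun k => ?_, ⟨⟨Finset.univ.image w, ?_⟩,
    (eventually_atLeastWitnessesNeeded hm).self_of_nhds⟩,
    fun ε hε => exists_perturbation hm hw2 hw1 hε⟩
  · have := rad_pos k
    rw [rad_succ, mul_div_assoc, div_self this.ne']
    norm_num [this]
  · rw [Finset.coe_image, Finset.coe_univ, Set.image_univ]
    exact witnessGabrielGraph_eq hw2 hw1
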